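/- Consider the equation $$h''(z)+\Big(1+\frac1{4z^2}\Big)h(z)=0. \qquad (*)$$ It admits a holomorphic fundamental system $\{h_+,h_-\}$ in the upper half-plane $\Im z>0$ (every holomorphic solution of $(*)$ there is a linear combination of $h_+$ and $h_-$ in exactly one way). Both functions extend to holomorphic solutions of $(*)$ in a neighbourhood of every point of $\{\Im z\ge 0,\ z\ne0\}$, and the following holds. (1) Recessive branch. Let $\Omega_+=\{z\in\mathbb C:\Im z\ge0,\ |z|\ge1\}$. Then $h_+(z)\sim e^{iz}$ as $|z|\to\infty$, $z\in\Omega_+$, and there is a constant $C$ such that for all $z\in\Omega_+$ $$|e^{-iz}h_+(z)|\le C,\qquad |z^2(e^{-iz}h_+(z))'|\le C,\qquad |z^3(e^{-iz}h_+(z))''|\le C.$$ (2) Dominant branch. For $\delta\in(0,1)$ let $\Omega_{+,\delta}=\{z\in\mathbb C:\Im z\ge0,\ |z|\ge1,\ \Im z\ge-\delta\,\Re z\}$. Then for every $\delta\in(0,1)$, $h_-(z)\sim e^{-iz}$ as $|z|\to\infty$, $z\in\Omega_{+,\delta}$. There are a constant $C$ independent of $\delta$ and, for every $\delta\in(0,1)$,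 a constant $C_\delta$ such that for all $z\in\Omega_{+,\delta}$ $$|e^{iz}h_-(z)|\le C,\qquad |e^{iz}h_-'(z)|\le C,\qquad |z^2(e^{iz}h_-(z))'|\le C_\delta .$$ Any constants $C_\delta$ with this property satisfy $C_\delta\to\infty$ as $\delta\to0^+$. (3) Stokes phenomenon. On the real axis, $h_-(x)\sim e^{-ix}+2i\,e^{ix}$ as $x\to-\infty$. (4) The analogous statement, obtained by complex conjugation, holds in the lower half-plane: $(*)$ has a holomorphic fundamental system $\{\tilde h_+,\tilde h_-\}$ in $\Im z<0$, whose members extend to holomorphic solutions of $(*)$ near every point of $\{\Im z\le0,\ z\neq0\}$, such that (1)–(3) hold with $\tilde h_\pm$ in place of $h_\pm$, with $i$ replaced by $-i$ throughout, and with $\Im z$ replaced by $-\Im z$ in the definitions of the regions. In particular $\tilde h_+(z)\sim e^{-iz}$, $\tilde h_-(z)\sim e^{iz}$ in the respective regions, and $\tilde h_-(x)\sim e^{ix}-2i\,e^{-ix}$ as $x\to-\infty$. -/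

import Mathlib

open Filter Topology Asymptotics

/-- `h` is holomorphic in a neighbourhood of every point of `U` (so that `deriv` is the genuine
complex derivative at every point of `U`, also at boundary points) and satisfies
`h'' + (1 + 1 / (4 z ^ 2)) h = 0` on `U`. For open `U` this is a holomorphic solution on `U`. -/
def IsBesselSolutionOn (U : Set ℂ) (h : ℂ → ℂ) : Prop :=
  AnalyticOnNhd ℂ h U ∧
    ∀ z ∈ U, deriv (deriv h) z + (1 + 1 / (4 * z ^ 2)) * h z = 0

/-- `f`, `g` form a fundamental system on `U`: both are holomorphic solutions, and every
holomorphic solution on `U` is a linear combination of `f` and `g` in exactly one way. -/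
def IsBesselFundamentalSystemOn (U : Set ℂ) (f g : ℂ → ℂ) : Prop :=
  IsBesselSolutionOn U f ∧ IsBesselSolutionOn U g ∧
    ∀ h : ℂ → ℂ, IsBesselSolutionOn U h →
      ∃! c : ℂ × ℂ, ∀ z ∈ U, h z = c.1 * f z + c.2 * g z

/-- The open half-plane `ε * Im z > 0`: the upper one for `ε = 1`, the lower one for `ε = -1`. -/
def openHalfPlane (ε : ℝ) : Set ℂ := {z | 0 < ε * z.im}

/-- The closed half-plane `ε * Im z ≥ 0` without the origin. -/
def puncturedClosedHalfPlane (ε : ℝ) : Set ℂ := {z | 0 ≤ ε * z.im ∧ z ≠ 0}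

/-- The region `ε * Im z ≥ 0`, `|z| ≥ 1`. -/
def exteriorRegion (ε : ℝ) : Set ℂ := {z | 0 ≤ ε * z.im ∧ 1 ≤ ‖z‖}

/-- The region `ε * Im z ≥ 0`, `|z| ≥ 1`, `ε * Im z ≥ - δ * Re z`. -/
def sectorRegion (ε δ : ℝ) : Set ℂ :=
  {z | 0 ≤ ε * z.im ∧ 1 ≤ ‖z‖ ∧ -δ * z.re ≤ ε * z.im}

/-- The filter `|z| → ∞` within `S`. -/
noncomputable def infinityWithin (S : Set ℂ) : Filter ℂ := Bornology.cobounded ℂ ⊓ 𝓟 S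

open MeasureTheory Set
open scoped ComplexConjugate

/-! Up to the factor `√z` the equation is Bessel's equation of order zero, and everything is read
off from explicit integrals. For `κ = ±i` the ansatz `h = e^(κz) F(κp/(2z)) / F(0)` with `F(w) = ∫
t^(-1/2) e^(-pt) (1+tw)^(-1/2) dt` solves it. Dominated convergence as `w → 0` inside a cone
avoiding the negative axis gives `h ~ e^(κz)`, and uniform bounds for `F` and its derivatives on the
cone give the estimates of the amplitude `e^(-κz) h`. The parameter `p` rotates the ray of
integration and hence the cut in the `z`-plane: `P` (`κ = i`, `p = 1`) is cut along the negative
imaginary axis, `K` (`κ = -i`, `p = 1`) along the positive one, and `Q` (`κ = -i`, `p = 1 + i`)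
along the ray through `-1 + i`. Thus `P` is the recessive branch, and `Q` is the dominant branch
until its cut is met.

The Stokes constant comes from the solution `J` proportional to `√z J₀(z)`. It is a combination of
`P` and `K` on `Re z > 0`; the symmetries `J(z) = i J(-z)` for `Re z < 0` and `P(-z) = K(z)`
transport this to the left half-plane. Constancy of the Wronskian of `P` and `J` on `Re z + Im z >
0`, which meets both half-planes, forces `J = a(P + iK)` on the right and `J = a(iK - P)` on the
left (`exists_besselConnection`). Eliminating `J` shows that `Q` continues to `K + 2iP` on the left
(`exists_dominantBranch`).

There the amplitude of the dominant branch carries the extra term `2i e^(2iz)` times a bounded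
factor. It is bounded in the closed half-plane, exponentially small in each sector, and of modulus
tending to 2 along the negative real axis. This accounts at once for the uniform bounds, for the
sector-dependent one and for its blow-up. The lower half-plane follows by reflection, since the
equation has real coefficients. -/

/-! ### The Laplace integral and its differential equation. -/

theorem HasDerivAt.div_pow_mul_cpow {t w : ℂ} (k : ℕ) (h : 1 + t * w ∈ Complex.slitPlane) :
    HasDerivAt (fun w : ℂ => (t / (1 + t * w)) ^ k * (1 + t * w) ^ (-(1 / 2) : ℂ))
      (-((k : ℂ) + 1 / 2) * ((t / (1 + t * w)) ^ (k + 1) * (1 + t * w) ^ (-(1 / 2) : ℂ))) w := by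
  have hX : 1 + t * w ≠ 0 := Complex.slitPlane_ne_zero h
  have h1 : HasDerivAt (fun w : ℂ => 1 + t * w) t w := by
    simpa using ((hasDerivAt_id w).const_mul t).const_add 1
  have h2 := (((hasDerivAt_const w t).fun_div h1 hX).fun_pow k).fun_mul (h1.cpow_const (c := -(1 / 2)) h)
  refine h2.congr_deriv ?_
  rw [Complex.cpow_sub _ _ hX, Complex.cpow_one]
  rcases k with _ | k
  · simp; ring
  · simp only [Nat.add_sub_cancel, Nat.cast_succ]
    generalize (1 + t * w) ^ (-(1 / 2) : ℂ) = Y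
    generalize 1 + t * w = X
    have e1 : (0 * X - t * t) / X ^ 2 = -(t / X) ^ 2 := by rw [div_pow]; ring
    have e2 : -(1 / 2) * (Y / X) * t = -(1 / 2) * Y * (t / X) := by ring
    rw [e1, e2]
    ring

/-- The cone of all `w` at a positive angle (measured by `K`) from the negative real axis. -/
def obliqueCone (K : ℝ) : Set ℂ := {w | -w.re ≤ K * |w.im|}

/-- If the real part of `1 + tw` is small, then `t Re w` is close to `-1`, and the cone condition
makes the imaginary part large. This keeps the integrand away from its singularity, uniformly in `t`
and `w`. -/
theorem one_le_mul_norm_one_add_mul {K : ℝ} (hK : 0 ≤ K) {w : ℂ} (hw : w ∈ obliqueCone K) {t : ℝ}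
    (ht : 0 ≤ t) : 1 ≤ (1 + K) * ‖1 + (t : ℂ) * w‖ := by
  have h1 := Complex.re_le_norm (1 + (t : ℂ) * w)
  have h2 := Complex.abs_im_le_norm (1 + (t : ℂ) * w)
  simp [abs_mul, abs_of_nonneg ht] at h1 h2
  have h3 := mul_le_mul_of_nonneg_left (hw : -w.re ≤ K * |w.im|) ht
  have h4 := mul_le_mul_of_nonneg_left h2 hK
  nlinarith

theorem one_add_mul_mem_slitPlane {K : ℝ} {w : ℂ} (hw : w ∈ obliqueCone K) {t : ℝ}
    (ht : 0 ≤ t) : 1 + (t : ℂ) * w ∈ Complex.slitPlane := by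
  rw [Complex.mem_slitPlane_iff]
  by_cases h : (1 + (t : ℂ) * w).im = 0
  · left
    have h3 := mul_le_mul_of_nonneg_left (hw : -w.re ≤ K * |w.im|) ht
    simp at h
    rcases h with h | h
    · simp [h]
    · simp [h] at h3 ⊢
      linarith
  · exact Or.inr h

/-- Supplies a locally uniform dominating function, as needed to differentiate under the integral
sign. -/
theorem exists_obliqueCone_mem_nhds {w : ℂ} (hw : w ∈ Complex.slitPlane) :
    ∃ K, 0 ≤ K ∧ obliqueCone K ∈ 𝓝 w := by
  rw [Complex.mem_slitPlane_iff] at hw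
  rcases hw with hw | hw
  · refine ⟨0, le_rfl, ?_⟩
    filter_upwards [(Complex.continuous_re.continuousAt (x := w)).eventually (lt_mem_nhds hw)] with v hv
    simp [obliqueCone]
    exact hv.le
  · refine ⟨(|w.re| + 1) / |w.im|, by positivity, ?_⟩
    have hc : ContinuousAt (fun v : ℂ => (|w.re| + 1) / |w.im| * |v.im| + v.re) w := by fun_prop
    have h0 : (0 : ℝ) < (|w.re| + 1) / |w.im| * |w.im| + w.re := by
      rw [div_mul_cancel₀ _ (abs_ne_zero.2 hw)]
      linarith [neg_abs_le w.re]
    filter_upwards [hc.eventually (lt_mem_nhds h0)] with v hv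
    simp only [obliqueCone, mem_ofPred_eq]
    linarith

/-- The integrand of `confluentIntegral`. -/
noncomputable def confluentIntegrand (p : ℂ) (k : ℕ) (w : ℂ) (t : ℝ) : ℂ :=
  ((t ^ (-(1 / 2) : ℝ) : ℝ) : ℂ) * Complex.exp (-(p * t)) *
    ((t / (1 + t * w)) ^ k * (1 + t * w) ^ (-(1 / 2) : ℂ))

/-- The Laplace integral `∫ t ^ (k - 1 / 2) e ^ (-p t) (1 + t w) ^ (-k - 1 / 2)` over `t > 0`. -/
noncomputable def confluentIntegral (p : ℂ) (k : ℕ) (w : ℂ) : ℂ :=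
  ∫ t in Ioi (0 : ℝ), confluentIntegrand p k w t

/-- A dominating function for `confluentIntegrand` on `obliqueCone K`. -/
noncomputable def confluentBound (p : ℂ) (k : ℕ) (K : ℝ) (t : ℝ) : ℝ :=
  (1 + K) ^ k * (1 + K) ^ (1 / 2 : ℝ) * (t ^ ((k : ℝ) - 1 / 2) * Real.exp (-p.re * t))

theorem norm_confluentIntegrand_le {p : ℂ} (k : ℕ) {K : ℝ} (hK : 0 ≤ K) {w : ℂ}
    (hw : w ∈ obliqueCone K) {t : ℝ} (ht : 0 < t) :
    ‖confluentIntegrand p k w t‖ ≤ confluentBound p k K t := by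
  have h := one_le_mul_norm_one_add_mul hK hw ht.le
  have hX : 0 < ‖1 + (t : ℂ) * w‖ := by
    by_contra hc
    nlinarith [norm_nonneg (1 + (t : ℂ) * w)]
  have e : (-(1 / 2) : ℂ) = ((-(1 / 2) : ℝ) : ℂ) := by push_cast; ring
  have hinv : ‖1 + (t : ℂ) * w‖⁻¹ ≤ 1 + K := by
    rw [inv_le_iff_one_le_mul₀ hX]; exact h
  have h1 : (‖1 + (t : ℂ) * w‖⁻¹) ^ (1 / 2 : ℝ) ≤ (1 + K) ^ (1 / 2 : ℝ) :=
    Real.rpow_le_rpow (by positivity) hinv (by norm_num)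
  have h2 : (‖1 + (t : ℂ) * w‖⁻¹) ^ k ≤ (1 + K) ^ k := pow_le_pow_left₀ (by positivity) hinv k
  rw [confluentIntegrand, confluentBound, e, norm_mul, norm_mul, norm_mul, Complex.norm_cpow_real,
    norm_pow, norm_div, Complex.norm_real, Complex.norm_real, Complex.norm_exp, Real.norm_of_nonneg ht.le,
    Real.norm_of_nonneg (by positivity), Real.rpow_neg (norm_nonneg _), ← Real.inv_rpow (norm_nonneg _),
    div_eq_mul_inv t, mul_pow]
  have h3 : t ^ ((k : ℝ) - 1 / 2) = t ^ k * t ^ (-(1 / 2) : ℝ) := by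
    rw [sub_eq_add_neg, Real.rpow_add ht, Real.rpow_natCast]
  have h4 : (-(p * (t : ℂ))).re = -p.re * t := by simp
  rw [h3, h4]
  calc _ = ((‖1 + (t : ℂ) * w‖⁻¹) ^ k * (‖1 + (t : ℂ) * w‖⁻¹) ^ (1 / 2 : ℝ)) *
        (t ^ k * t ^ (-(1 / 2) : ℝ) * Real.exp (-p.re * t)) := by ring
    _ ≤ _ := by gcongr

theorem integrableOn_confluentBound {p : ℂ} (hp : 0 < p.re) (k : ℕ) (K : ℝ) :
    IntegrableOn (confluentBound p k K) (Ioi 0) := by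
  have h := integrableOn_rpow_mul_exp_neg_mul_rpow (p := 1) (s := (k : ℝ) - 1 / 2) (b := p.re)
    (by have : (0 : ℝ) ≤ k := k.cast_nonneg
        linarith) one_pos hp
  simp only [Real.rpow_one] at h
  exact h.const_mul _

theorem continuousOn_confluentIntegrand (p : ℂ) (k : ℕ) {K : ℝ} {w : ℂ} (hw : w ∈ obliqueCone K) :
    ContinuousOn (confluentIntegrand p k w) (Ioi 0) := by
  intro t ht
  have ht' : (0 : ℝ) < t := ht
  have hs := one_add_mul_mem_slitPlane hw ht'.le
  have hX := Complex.slitPlane_ne_zero hs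
  apply ContinuousAt.continuousWithinAt
  have c1 : ContinuousAt (fun t : ℝ => ((t ^ (-(1 / 2) : ℝ) : ℝ) : ℂ)) t :=
    Complex.continuous_ofReal.continuousAt.comp (Real.continuousAt_rpow_const _ _ (Or.inl ht'.ne'))
  have c2 : ContinuousAt (fun t : ℝ => 1 + (t : ℂ) * w) t := by fun_prop
  have c3 : ContinuousAt (fun t : ℝ => (1 + (t : ℂ) * w) ^ (-(1 / 2) : ℂ)) t :=
    c2.cpow continuousAt_const hs
  have c4 : ContinuousAt (fun t : ℝ => (t : ℂ) / (1 + (t : ℂ) * w)) t :=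
    Complex.continuous_ofReal.continuousAt.div c2 hX
  exact (c1.mul (by fun_prop)).mul ((c4.pow k).mul c3)

theorem integrableOn_confluentIntegrand {p : ℂ} (hp : 0 < p.re) (k : ℕ) {K : ℝ} (hK : 0 ≤ K) {w : ℂ}
    (hw : w ∈ obliqueCone K) : IntegrableOn (confluentIntegrand p k w) (Ioi 0) := by
  refine (integrableOn_confluentBound hp k K).mono'
    ((continuousOn_confluentIntegrand p k hw).aestronglyMeasurable measurableSet_Ioi) ?_
  filter_upwards [ae_restrict_mem measurableSet_Ioi] with t ht
  exact norm_confluentIntegrand_le k hK hw ht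

theorem exists_norm_confluentIntegral_le {p : ℂ} (hp : 0 < p.re) (k : ℕ) {K : ℝ} (hK : 0 ≤ K) :
    ∃ C, 0 ≤ C ∧ ∀ w ∈ obliqueCone K, ‖confluentIntegral p k w‖ ≤ C := by
  refine ⟨∫ t in Ioi (0 : ℝ), confluentBound p k K t, ?_, fun w hw => ?_⟩
  · refine setIntegral_nonneg measurableSet_Ioi fun t ht => ?_
    have : (0 : ℝ) < t := ht
    unfold confluentBound
    positivity
  · refine norm_integral_le_of_norm_le (integrableOn_confluentBound hp k K) ?_
    filter_upwards [ae_restrict_mem measurableSet_Ioi] with t ht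
    exact norm_confluentIntegrand_le k hK hw ht

/-- The index `k` exists so that the family is closed under differentiation: each derivative in `w`
is a multiple of the next member, with the same kind of bound. -/
theorem hasDerivAt_confluentIntegral {p : ℂ} (hp : 0 < p.re) (k : ℕ) {w : ℂ}
    (hw : w ∈ Complex.slitPlane) :
    HasDerivAt (confluentIntegral p k) (-((k : ℂ) + 1 / 2) * confluentIntegral p (k + 1) w) w := by
  obtain ⟨K, hK, hmem⟩ := exists_obliqueCone_mem_nhds hw
  have hw' := mem_of_mem_nhds hmem
  have h := (hasDerivAt_integral_of_dominated_loc_of_deriv_le (μ := volume.restrict (Ioi (0 : ℝ)))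
    (F := confluentIntegrand p k)
    (F' := fun w t => -((k : ℂ) + 1 / 2) * confluentIntegrand p (k + 1) w t)
    (bound := fun t => ‖-((k : ℂ) + 1 / 2)‖ * confluentBound p (k + 1) K t) hmem
    (by
      filter_upwards [hmem] with v hv
      exact (continuousOn_confluentIntegrand p k hv).aestronglyMeasurable measurableSet_Ioi)
    (integrableOn_confluentIntegrand hp k hK hw')
    (((continuousOn_confluentIntegrand p (k + 1) hw').aestronglyMeasurable
      measurableSet_Ioi).const_mul _)
    (by
      filter_upwards [ae_restrict_mem measurableSet_Ioi] with t ht v hv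
      rw [norm_mul]
      exact mul_le_mul_of_nonneg_left (norm_confluentIntegrand_le (k + 1) hK hv ht) (norm_nonneg _))
    ((integrableOn_confluentBound hp (k + 1) K).const_mul _)
    (by
      filter_upwards [ae_restrict_mem measurableSet_Ioi] with t ht v hv
      have ht' : (0 : ℝ) < t := ht
      have := (HasDerivAt.div_pow_mul_cpow k (one_add_mul_mem_slitPlane hv ht'.le)).const_mul
        (((t ^ (-(1 / 2) : ℝ) : ℝ) : ℂ) * Complex.exp (-(p * t)))
      refine this.congr_deriv ?_
      rw [confluentIntegrand]
      ring)).2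
  refine h.congr_deriv ?_
  rw [integral_const_mul]
  rfl

/-- The point `w = 0` is the image of `z = ∞` and is not in the slit plane, so only continuity along
a cone is available; this is what yields the asymptotics. -/
theorem continuousWithinAt_confluentIntegral_zero {p : ℂ} (hp : 0 < p.re) (k : ℕ) {K : ℝ}
    (hK : 0 ≤ K) : ContinuousWithinAt (confluentIntegral p k) (obliqueCone K) 0 := by
  refine continuousWithinAt_of_dominated (bound := confluentBound p k K) ?_ ?_
    (integrableOn_confluentBound hp k K) ?_
  · filter_upwards [self_mem_nhdsWithin] with v hv
    exact (continuousOn_confluentIntegrand p k hv).aestronglyMeasurable measurableSet_Ioi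
  · filter_upwards [self_mem_nhdsWithin] with v hv
    filter_upwards [ae_restrict_mem measurableSet_Ioi] with t ht
    exact norm_confluentIntegrand_le k hK hv ht
  · filter_upwards [ae_restrict_mem measurableSet_Ioi] with t ht
    apply ContinuousAt.continuousWithinAt
    have := (HasDerivAt.div_pow_mul_cpow (t := t) (w := 0) k (by simp)).continuousAt
    exact continuousAt_const.mul this

theorem confluentIntegral_zero_ne_zero {p : ℂ} (hp : 0 < p.re) : confluentIntegral p 0 0 ≠ 0 := by
  -- The substitution `t = x²` turns the integral at `w = 0` into a Gaussian one, with value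
  -- `√(π/p)`.
  have h := integral_comp_rpow_Ioi_of_pos (g := fun x : ℝ => Complex.exp (-p * (x : ℂ) ^ 2))
    (p := 1 / 2) (by norm_num)
  have h2 : confluentIntegral p 0 0 = 2 * ((Real.pi / p) ^ (1 / 2 : ℂ) / 2) := by
    rw [← integral_gaussian_complex_Ioi hp, ← h, ← integral_const_mul]
    refine setIntegral_congr_fun measurableSet_Ioi fun t ht => ?_
    have ht' : (0 : ℝ) ≤ t := le_of_lt ht
    have e : (((t ^ (1 / 2 : ℝ) : ℝ) : ℂ)) ^ 2 = t := by
      rw [← Real.sqrt_eq_rpow, ← Complex.ofReal_pow, Real.sq_sqrt ht']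
    simp only [confluentIntegrand, e, Complex.real_smul]
    norm_num
    ring
  have hp0 : p ≠ 0 := by rintro rfl; simp at hp
  rw [h2]
  simp [hp0, Real.pi_ne_zero]

/-- This is `w² F'' + (2w + p) F' + F/4 = 0` with the derivatives written as members of the family.
The combination of integrands is a total derivative in `t`. -/
theorem confluentIntegral_ode {p : ℂ} (hp : 0 < p.re) {w : ℂ} (hw : w ∈ Complex.slitPlane) :
    w ^ 2 * (3 / 4 * confluentIntegral p 2 w) - (2 * w + p) * (1 / 2 * confluentIntegral p 1 w) +
      1 / 4 * confluentIntegral p 0 w = 0 := by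
  obtain ⟨K, hK, hmem⟩ := exists_obliqueCone_mem_nhds hw
  have hw' := mem_of_mem_nhds hmem
  -- The primitive `½ t^(1/2) e^(-pt) (1+tw)^(-3/2)`, which vanishes at both ends.
  set f : ℝ → ℂ := fun t => 1 / 2 * ((t ^ (1 / 2 : ℝ) : ℝ) : ℂ) * Complex.exp (-(p * t)) *
    ((1 + t * w) ^ (-(1 / 2) : ℂ) / (1 + t * w)) with hf
  have i0 := integrableOn_confluentIntegrand hp 0 hK hw'
  have i1 := integrableOn_confluentIntegrand hp 1 hK hw'
  have i2 := integrableOn_confluentIntegrand hp 2 hK hw'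
  have j0 := i0.const_mul (1 / 4)
  have j1 := i1.const_mul ((2 * w + p) * (1 / 2))
  have j2 := i2.const_mul (w ^ 2 * (3 / 4))
  have j21 : IntegrableOn (fun t => w ^ 2 * (3 / 4) * confluentIntegrand p 2 w t -
      (2 * w + p) * (1 / 2) * confluentIntegrand p 1 w t) (Ioi 0) := j2.sub j1
  have key := integral_Ioi_of_hasDerivAt_of_tendsto (f := f) (a := 0) (m := 0)
    (f' := fun t => w ^ 2 * (3 / 4) * confluentIntegrand p 2 w t -
      (2 * w + p) * (1 / 2) * confluentIntegrand p 1 w t + 1 / 4 * confluentIntegrand p 0 w t)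
    ?_ ?_ (j21.add j0) ?_
  · rw [integral_add j21 j0, integral_sub j2 j1] at key
    simp only [integral_const_mul] at key
    simp [hf] at key
    simp only [confluentIntegral]
    linear_combination key
  · apply ContinuousAt.continuousWithinAt
    have c1 : ContinuousAt (fun t : ℝ => ((t ^ (1 / 2 : ℝ) : ℝ) : ℂ)) 0 :=
      Complex.continuous_ofReal.continuousAt.comp
        (Real.continuousAt_rpow_const _ _ (Or.inr (by norm_num)))
    have c2 : ContinuousAt (fun t : ℝ => 1 + (t : ℂ) * w) 0 := by fun_prop
    have c3 : ContinuousAt (fun t : ℝ => (1 + (t : ℂ) * w) ^ (-(1 / 2) : ℂ)) 0 :=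
      c2.cpow continuousAt_const (by simp)
    exact ((continuousAt_const.mul c1).mul (by fun_prop)).mul (c3.div c2 (by simp))
  · intro t ht
    have ht' : (0 : ℝ) < t := ht
    have hs := one_add_mul_mem_slitPlane hw' ht'.le
    have hX := Complex.slitPlane_ne_zero hs
    have d1 : HasDerivAt (fun t : ℝ => ((t ^ (1 / 2 : ℝ) : ℝ) : ℂ))
        ((1 / 2 * t ^ (-(1 / 2) : ℝ) : ℝ) : ℂ) t := by
      have := (Real.hasDerivAt_rpow_const (x := t) (p := 1 / 2) (Or.inl ht'.ne')).ofReal_comp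
      refine this.congr_deriv ?_
      norm_num
    have d2 : HasDerivAt (fun t : ℝ => 1 + (t : ℂ) * w) w t := by
      simpa using (((hasDerivAt_id (t : ℂ)).mul_const w).const_add 1).comp_ofReal
    have d3 : HasDerivAt (fun t : ℝ => (1 + (t : ℂ) * w) ^ (-(1 / 2) : ℂ))
        (-(1 / 2) * (1 + t * w) ^ (-(1 / 2) - 1 : ℂ) * w) t := by
      have : HasDerivAt (fun t : ℂ => 1 + t * w) w (t : ℂ) := by
        simpa using ((hasDerivAt_id (t : ℂ)).mul_const w).const_add 1
      exact (this.cpow_const (c := -(1 / 2)) hs).comp_ofReal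
    have d4 : HasDerivAt (fun t : ℝ => Complex.exp (-(p * t))) (Complex.exp (-(p * t)) * (-p)) t := by
      have : HasDerivAt (fun t : ℂ => -(p * t)) (-p) (t : ℂ) := by
        simpa using ((hasDerivAt_id (t : ℂ)).const_mul p).fun_neg
      exact this.cexp.comp_ofReal
    have d := ((d1.const_mul (1 / 2 : ℂ)).fun_mul d4).fun_mul (d3.fun_div d2 hX)
    refine d.congr_deriv ?_
    have e : t ^ (1 / 2 : ℝ) = t * t ^ (-(1 / 2) : ℝ) := by
      conv_rhs => rw [← Real.rpow_one_add' ht'.le (by norm_num)]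
      norm_num
    simp only [confluentIntegrand]
    rw [Complex.cpow_sub _ _ hX, Complex.cpow_one, e]
    push_cast
    generalize (1 + (t : ℂ) * w) ^ (-(1 / 2) : ℂ) = Y
    generalize ((t ^ (-(1 / 2) : ℝ) : ℝ) : ℂ) = T
    generalize Complex.exp (-(p * t)) = E
    field_simp
    ring
  · have hb : Tendsto (fun t : ℝ => 1 / 2 * confluentBound p 1 K t) atTop (𝓝 0) := by
      have h1 := tendsto_rpow_mul_exp_neg_mul_atTop_nhds_zero (1 / 2) p.re hp
      have h2 := (h1.const_mul ((1 + K) ^ 1 * (1 + K) ^ (1 / 2 : ℝ))).const_mul (1 / 2)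
      simp only [mul_zero] at h2
      refine h2.congr fun t => ?_
      rw [confluentBound]
      norm_num
    refine squeeze_zero_norm' ?_ hb
    filter_upwards [eventually_gt_atTop 0] with t ht
    have h1 := norm_confluentIntegrand_le (p := p) 1 hK hw' ht
    have e : t ^ (1 / 2 : ℝ) = t * t ^ (-(1 / 2) : ℝ) := by
      conv_rhs => rw [← Real.rpow_one_add' ht.le (by norm_num)]
      norm_num
    -- The primitive is itself half of the integrand with `k = 1`, so the dominating function
    -- controls its decay.
    have e2 : f t = 1 / 2 * confluentIntegrand p 1 w t := by
      simp only [hf, confluentIntegrand, e]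
      push_cast
      ring
    rw [e2, norm_mul]
    norm_num
    linarith

/-! ### Solutions, Wronskians and fundamental systems. -/

theorem isBesselSolutionOn_of_hasDerivAt {U : Set ℂ} (hU : IsOpen U) {h h₁ h₂ : ℂ → ℂ}
    (d₀ : ∀ z ∈ U, HasDerivAt h (h₁ z) z) (d₁ : ∀ z ∈ U, HasDerivAt h₁ (h₂ z) z)
    (ode : ∀ z ∈ U, h₂ z + (1 + 1 / (4 * z ^ 2)) * h z = 0) : IsBesselSolutionOn U h := by
  refine ⟨DifferentiableOn.analyticOnNhd
    (fun z hz => (d₀ z hz).differentiableAt.differentiableWithinAt) hU, fun z hz => ?_⟩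
  have e : deriv h =ᶠ[𝓝 z] h₁ := by
    filter_upwards [hU.mem_nhds hz] with v hv using (d₀ v hv).deriv
  rw [e.deriv_eq, (d₁ z hz).deriv]
  exact ode z hz

theorem IsBesselSolutionOn.mono {U V : Set ℂ} {h : ℂ → ℂ} (hV : IsBesselSolutionOn V h)
    (hUV : U ⊆ V) : IsBesselSolutionOn U h :=
  ⟨hV.1.mono hUV, fun z hz => hV.2 z (hUV hz)⟩

theorem IsBesselSolutionOn.hasDerivAt {U : Set ℂ} {h : ℂ → ℂ} (hh : IsBesselSolutionOn U h) {z : ℂ}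
    (hz : z ∈ U) : HasDerivAt h (deriv h z) z :=
  (hh.1 z hz).differentiableAt.hasDerivAt

theorem IsBesselSolutionOn.hasDerivAt_deriv {U : Set ℂ} {h : ℂ → ℂ} (hh : IsBesselSolutionOn U h)
    {z : ℂ} (hz : z ∈ U) : HasDerivAt (deriv h) (-((1 + 1 / (4 * z ^ 2)) * h z)) z := by
  have := (hh.1 z hz).deriv.differentiableAt.hasDerivAt
  rwa [eq_neg_of_add_eq_zero_left (hh.2 z hz)] at this

theorem IsBesselSolutionOn.linear_combination {U : Set ℂ} {f g : ℂ → ℂ}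
    (hf : IsBesselSolutionOn U f) (hg : IsBesselSolutionOn U g) (hU : IsOpen U) (a b : ℂ) :
    IsBesselSolutionOn U (fun z => a * f z + b * g z) :=
  isBesselSolutionOn_of_hasDerivAt hU
    (fun _ hz => ((hf.hasDerivAt hz).const_mul a).fun_add ((hg.hasDerivAt hz).const_mul b))
    (fun _ hz => ((hf.hasDerivAt_deriv hz).const_mul a).fun_add
      ((hg.hasDerivAt_deriv hz).const_mul b))
    (fun z hz => by ring)

/-- The Wronskian of two functions. -/
noncomputable def wronskian (f g : ℂ → ℂ) (z : ℂ) : ℂ := f z * deriv g z - deriv f z * g z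

theorem wronskian_eq_of_isBesselSolutionOn {U : Set ℂ} (hU : IsOpen U) (hc : IsPreconnected U)
    {f g : ℂ → ℂ} (hf : IsBesselSolutionOn U f) (hg : IsBesselSolutionOn U g) {z v : ℂ} (hz : z ∈ U)
    (hv : v ∈ U) : wronskian f g z = wronskian f g v := by
  have hd : ∀ z ∈ U, HasDerivAt (wronskian f g) 0 z := fun z hz => by
    refine (((hf.hasDerivAt hz).fun_mul (hg.hasDerivAt_deriv hz)).fun_sub
      ((hf.hasDerivAt_deriv hz).fun_mul (hg.hasDerivAt hz))).congr_deriv ?_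
    ring
  exact hU.is_const_of_deriv_eq_zero hc
    (fun z hz => (hd z hz).differentiableAt.differentiableWithinAt)
    (fun z hz => (hd z hz).deriv) hz hv

/-- Cramer's rule with constant Wronskians; no existence and uniqueness theorem for the equation is
needed. -/
theorem IsBesselSolutionOn.eq_combination {U : Set ℂ} (hU : IsOpen U) (hc : IsPreconnected U)
    {f g h : ℂ → ℂ} (hf : IsBesselSolutionOn U f) (hg : IsBesselSolutionOn U g)
    (hh : IsBesselSolutionOn U h) {v : ℂ} (hv : v ∈ U) (hW : wronskian f g v ≠ 0) {z : ℂ}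
    (hz : z ∈ U) :
    h z = wronskian h g v / wronskian f g v * f z + wronskian f h v / wronskian f g v * g z := by
  have h1 := wronskian_eq_of_isBesselSolutionOn hU hc hf hg hz hv
  have h2 := wronskian_eq_of_isBesselSolutionOn hU hc hh hg hz hv
  have h3 := wronskian_eq_of_isBesselSolutionOn hU hc hf hh hz hv
  have : h z * wronskian f g v = wronskian h g v * f z + wronskian f h v * g z := by
    rw [← h1, ← h2, ← h3]
    simp only [wronskian]
    ring
  field_simp
  linear_combination this

theorem isBesselFundamentalSystemOn_of_wronskian_ne_zero {U : Set ℂ} (hU : IsOpen U)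
    (hc : IsPreconnected U) {f g : ℂ → ℂ} (hf : IsBesselSolutionOn U f)
    (hg : IsBesselSolutionOn U g) {v : ℂ} (hv : v ∈ U) (hW : wronskian f g v ≠ 0) :
    IsBesselFundamentalSystemOn U f g := by
  refine ⟨hf, hg, fun h hh => ⟨(_, _), fun z hz => hf.eq_combination hU hc hg hh hv hW hz, ?_⟩⟩
  rintro ⟨a, b⟩ hab
  have e : h =ᶠ[𝓝 v] fun z => a * f z + b * g z := by
    filter_upwards [hU.mem_nhds hv] with z hz using hab z hz
  have e0 := e.eq_of_nhds
  have e1 : deriv h v = a * deriv f v + b * deriv g v := by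
    rw [e.deriv_eq]
    exact (((hf.hasDerivAt hv).const_mul a).fun_add ((hg.hasDerivAt hv).const_mul b)).deriv
  ext
  · simp only
    rw [eq_div_iff hW]
    simp only [wronskian, e0, e1]
    ring
  · simp only
    rw [eq_div_iff hW]
    simp only [wronskian, e0, e1]
    ring

/-! ### The branches with pure exponential asymptotics. -/

/-- The domain of holomorphy of `besselBranch κ p`. -/
def branchDomain (κ p : ℂ) : Set ℂ := {z | κ * p / (2 * z) ∈ Complex.slitPlane}

/-- The amplitude `e ^ (-κ z) h` of the solution `h ~ e ^ (κ z)`. -/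
noncomputable def branchAmplitude (κ p z : ℂ) : ℂ :=
  confluentIntegral p 0 (κ * p / (2 * z)) / confluentIntegral p 0 0

/-- The derivative of `branchAmplitude`. -/
noncomputable def branchAmplitudeDeriv (κ p z : ℂ) : ℂ :=
  κ * p / (4 * z ^ 2) * confluentIntegral p 1 (κ * p / (2 * z)) / confluentIntegral p 0 0

/-- The second derivative of `branchAmplitude`. -/
noncomputable def branchAmplitudeDeriv₂ (κ p z : ℂ) : ℂ :=
  (-(κ * p / (2 * z ^ 3)) * confluentIntegral p 1 (κ * p / (2 * z)) +
    3 / 16 * ((κ * p) ^ 2 / z ^ 4) * confluentIntegral p 2 (κ * p / (2 * z))) /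
      confluentIntegral p 0 0

/-- The solution asymptotic to `e ^ (κ z)`, where `κ ^ 2 = -1`; the direction `p` of the Laplace
integral only affects its domain. -/
noncomputable def besselBranch (κ p z : ℂ) : ℂ := Complex.exp (κ * z) * branchAmplitude κ p z

theorem ne_zero_of_mem_branchDomain {κ p z : ℂ} (hz : z ∈ branchDomain κ p) : z ≠ 0 := by
  rintro rfl
  simp [branchDomain] at hz

theorem isOpen_branchDomain (κ p : ℂ) : IsOpen (branchDomain κ p) := by
  rw [isOpen_iff_mem_nhds]
  intro z hz
  have hz0 := ne_zero_of_mem_branchDomain hz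
  have : ContinuousAt (fun z : ℂ => κ * p / (2 * z)) z :=
    continuousAt_const.div (by fun_prop) (by simpa using hz0)
  exact this.eventually (Complex.isOpen_slitPlane.mem_nhds hz)

section Branch

variable {κ p z : ℂ}

theorem hasDerivAt_div_two_mul (hz : z ≠ 0) :
    HasDerivAt (fun z : ℂ => κ * p / (2 * z)) (-(κ * p / (2 * z ^ 2))) z := by
  have := (hasDerivAt_const z (κ * p)).fun_div ((hasDerivAt_id z).const_mul 2) (by simpa using hz)
  refine this.congr_deriv ?_
  simp
  field_simp

theorem hasDerivAt_branchAmplitude (hp : 0 < p.re) (hz : z ∈ branchDomain κ p) :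
    HasDerivAt (branchAmplitude κ p) (branchAmplitudeDeriv κ p z) z := by
  have hz0 := ne_zero_of_mem_branchDomain hz
  have := ((hasDerivAt_confluentIntegral hp 0 hz).comp z (hasDerivAt_div_two_mul hz0)).div_const
    (confluentIntegral p 0 0)
  refine this.congr_deriv ?_
  rw [branchAmplitudeDeriv]
  simp only [zero_add, Nat.cast_zero]
  field_simp
  ring

theorem hasDerivAt_branchAmplitudeDeriv (hp : 0 < p.re) (hz : z ∈ branchDomain κ p) :
    HasDerivAt (branchAmplitudeDeriv κ p) (branchAmplitudeDeriv₂ κ p z) z := by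
  have hz0 := ne_zero_of_mem_branchDomain hz
  have d1 : HasDerivAt (fun z : ℂ => κ * p / (4 * z ^ 2)) (-(κ * p / (2 * z ^ 3))) z := by
    have := (hasDerivAt_const z (κ * p)).fun_div (((hasDerivAt_id z).fun_pow 2).const_mul 4)
      (by simpa using hz0)
    refine this.congr_deriv ?_
    simp
    field_simp
    ring
  have d2 := (hasDerivAt_confluentIntegral hp 1 hz).comp z (hasDerivAt_div_two_mul hz0)
  have := (d1.fun_mul d2).div_const (confluentIntegral p 0 0)
  refine this.congr_deriv ?_
  rw [branchAmplitudeDeriv₂]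
  simp only [Nat.cast_one, Nat.reduceAdd, Function.comp_apply]
  generalize confluentIntegral p 0 0 = c
  generalize confluentIntegral p 1 (κ * p / (2 * z)) = F₁
  generalize confluentIntegral p 2 (κ * p / (2 * z)) = F₂
  congr 2
  field_simp
  ring

theorem branchAmplitude_ode (hκ : κ ^ 2 = -1) (hp : 0 < p.re) (hz : z ∈ branchDomain κ p) :
    branchAmplitudeDeriv₂ κ p z + 2 * κ * branchAmplitudeDeriv κ p z +
      branchAmplitude κ p z / (4 * z ^ 2) = 0 := by
  have hz0 := ne_zero_of_mem_branchDomain hz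
  have h := confluentIntegral_ode hp hz
  rw [branchAmplitudeDeriv₂, branchAmplitudeDeriv, branchAmplitude]
  generalize confluentIntegral p 0 0 = c
  generalize confluentIntegral p 0 (κ * p / (2 * z)) = F₀ at *
  generalize confluentIntegral p 1 (κ * p / (2 * z)) = F₁ at *
  generalize confluentIntegral p 2 (κ * p / (2 * z)) = F₂ at *
  -- Writing `p` as `-κ² p` makes this an identity for arbitrary `κ`; only afterwards is `κ² = -1`
  -- used.
  have : (-(κ * p / (2 * z ^ 3)) * F₁ + 3 / 16 * ((κ * p) ^ 2 / z ^ 4) * F₂) / c +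
      2 * κ * (κ * p / (4 * z ^ 2) * F₁ / c) + F₀ / c / (4 * z ^ 2) =
      ((κ * p / (2 * z)) ^ 2 * (3 / 4 * F₂) - (2 * (κ * p / (2 * z)) + -κ ^ 2 * p) * (1 / 2 * F₁) +
        1 / 4 * F₀) / (z ^ 2 * c) := by
    by_cases hc : c = 0
    · simp [hc]
    · field_simp
      ring
  rw [this, hκ, neg_neg, one_mul, h, zero_div]

theorem hasDerivAt_besselBranch (hp : 0 < p.re) (hz : z ∈ branchDomain κ p) :
    HasDerivAt (besselBranch κ p)
      (Complex.exp (κ * z) * (branchAmplitudeDeriv κ p z + κ * branchAmplitude κ p z)) z := by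
  have d : HasDerivAt (fun z : ℂ => κ * z) κ z := by simpa using (hasDerivAt_id z).const_mul κ
  refine (d.cexp.fun_mul (hasDerivAt_branchAmplitude hp hz)).congr_deriv ?_
  ring

theorem isBesselSolutionOn_besselBranch (hκ : κ ^ 2 = -1) (hp : 0 < p.re) :
    IsBesselSolutionOn (branchDomain κ p) (besselBranch κ p) := by
  refine isBesselSolutionOn_of_hasDerivAt (isOpen_branchDomain κ p)
    (fun z hz => hasDerivAt_besselBranch hp hz)
    (h₂ := fun z => Complex.exp (κ * z) * (branchAmplitudeDeriv₂ κ p z +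
      2 * κ * branchAmplitudeDeriv κ p z + κ ^ 2 * branchAmplitude κ p z)) (fun z hz => ?_)
    (fun z hz => ?_)
  · have d : HasDerivAt (fun z : ℂ => κ * z) κ z := by simpa using (hasDerivAt_id z).const_mul κ
    refine (d.cexp.fun_mul ((hasDerivAt_branchAmplitudeDeriv hp hz).fun_add
      ((hasDerivAt_branchAmplitude hp hz).const_mul κ))).congr_deriv ?_
    ring
  · rw [besselBranch, hκ]
    linear_combination Complex.exp (κ * z) * branchAmplitude_ode hκ hp hz

theorem wronskian_besselBranch {κ' p' : ℂ} (hp : 0 < p.re) (hp' : 0 < p'.re)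
    (hz : z ∈ branchDomain κ p) (hz' : z ∈ branchDomain κ' p') :
    wronskian (besselBranch κ p) (besselBranch κ' p') z = Complex.exp ((κ + κ') * z) *
      (branchAmplitude κ p z * (branchAmplitudeDeriv κ' p' z + κ' * branchAmplitude κ' p' z) -
        (branchAmplitudeDeriv κ p z + κ * branchAmplitude κ p z) * branchAmplitude κ' p' z) := by
  rw [wronskian, (hasDerivAt_besselBranch hp hz).deriv, (hasDerivAt_besselBranch hp' hz').deriv,
    besselBranch, besselBranch, add_mul, Complex.exp_add]
  ring

/-- Each derivative in `z` gains powers of `1/z` through `w = κp/(2z)`, while the integrals stay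
bounded on the cone. -/
theorem exists_branchAmplitude_bound (hp : 0 < p.re) (κ : ℂ) {K : ℝ} (hK : 0 ≤ K) :
    ∃ C, 0 ≤ C ∧ ∀ z : ℂ, 1 ≤ ‖z‖ → κ * p / (2 * z) ∈ obliqueCone K →
      ‖branchAmplitude κ p z‖ ≤ C ∧ ‖z ^ 2 * branchAmplitudeDeriv κ p z‖ ≤ C ∧
        ‖z ^ 3 * branchAmplitudeDeriv₂ κ p z‖ ≤ C := by
  obtain ⟨C₀, h₀, b₀⟩ := exists_norm_confluentIntegral_le hp 0 hK
  obtain ⟨C₁, h₁, b₁⟩ := exists_norm_confluentIntegral_le hp 1 hK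
  obtain ⟨C₂, h₂, b₂⟩ := exists_norm_confluentIntegral_le hp 2 hK
  set c := ‖confluentIntegral p 0 0‖
  set m := ‖κ * p‖
  have hc : 0 ≤ c := norm_nonneg _
  have hm : 0 ≤ m := norm_nonneg _
  refine ⟨(C₀ + m * C₁ + m ^ 2 * C₂) / c, by positivity, fun z hz hw => ⟨?_, ?_, ?_⟩⟩
  all_goals have hz0 : z ≠ 0 := by rintro rfl; norm_num at hz
  · rw [branchAmplitude, norm_div]
    gcongr
    have := b₀ _ hw
    have : 0 ≤ m * C₁ + m ^ 2 * C₂ := by positivity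
    linarith
  · have e : z ^ 2 * branchAmplitudeDeriv κ p z =
        κ * p / 4 * confluentIntegral p 1 (κ * p / (2 * z)) / confluentIntegral p 0 0 := by
      rw [branchAmplitudeDeriv]
      generalize confluentIntegral p 1 (κ * p / (2 * z)) = F
      field_simp
    rw [e, norm_div, norm_mul, norm_div]
    gcongr
    have h1 : m / ‖(4 : ℂ)‖ * ‖confluentIntegral p 1 (κ * p / (2 * z))‖ ≤ m * C₁ := by
      gcongr
      · exact div_le_self hm (by norm_num)
      · exact b₁ _ hw
    have : 0 ≤ m ^ 2 * C₂ := by positivity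
    linarith
  · have e : z ^ 3 * branchAmplitudeDeriv₂ κ p z =
        (-(κ * p / 2) * confluentIntegral p 1 (κ * p / (2 * z)) +
          3 / 16 * ((κ * p) ^ 2 / z) * confluentIntegral p 2 (κ * p / (2 * z))) /
            confluentIntegral p 0 0 := by
      rw [branchAmplitudeDeriv₂]
      generalize confluentIntegral p 1 (κ * p / (2 * z)) = F
      generalize confluentIntegral p 2 (κ * p / (2 * z)) = G
      field_simp
    rw [e, norm_div]
    gcongr
    refine (norm_add_le _ _).trans ?_
    rw [norm_mul, norm_neg, norm_mul, norm_mul, norm_div, norm_div (_ ^ 2), norm_pow]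
    have h1 : m / ‖(2 : ℂ)‖ * ‖confluentIntegral p 1 (κ * p / (2 * z))‖ ≤ m * C₁ := by
      gcongr
      · exact div_le_self hm (by norm_num)
      · exact b₁ _ hw
    have h2 : ‖(3 / 16 : ℂ)‖ * (m ^ 2 / ‖z‖) * ‖confluentIntegral p 2 (κ * p / (2 * z))‖ ≤
        1 * m ^ 2 * C₂ := by
      gcongr
      · norm_num
      · exact div_le_self (by positivity) hz
      · exact b₂ _ hw
    linarith

theorem tendsto_branchAmplitude (hp : 0 < p.re) {K : ℝ} (hK : 0 ≤ K) {R : Set ℂ}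
    (hR : ∀ z ∈ R, κ * p / (2 * z) ∈ obliqueCone K) :
    Tendsto (branchAmplitude κ p) (infinityWithin R) (𝓝 1) := by
  have h0 : Tendsto (fun z : ℂ => κ * p / (2 * z)) (infinityWithin R) (𝓝[obliqueCone K] 0) := by
    refine tendsto_nhdsWithin_iff.2 ⟨?_, ?_⟩
    · have h1 : Tendsto (fun z : ℂ => κ * p / 2 * z⁻¹) (Bornology.cobounded ℂ) (𝓝 (κ * p / 2 * 0)) :=
        tendsto_inv₀_cobounded.const_mul _
      rw [mul_zero] at h1
      refine (h1.mono_left inf_le_left).congr fun z => ?_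
      ring
    · filter_upwards [mem_inf_of_right (mem_principal_self R)] with z hz using hR z hz
  have h1 := ((continuousWithinAt_confluentIntegral_zero hp 0 hK).tendsto.comp h0).div_const
    (confluentIntegral p 0 0)
  rwa [div_self (confluentIntegral_zero_ne_zero hp)] at h1

theorem tendsto_branchAmplitudeDeriv (hp : 0 < p.re) {K : ℝ} (hK : 0 ≤ K) {R : Set ℂ}
    (hR : ∀ z ∈ R, κ * p / (2 * z) ∈ obliqueCone K) :
    Tendsto (branchAmplitudeDeriv κ p) (infinityWithin R) (𝓝 0) := by
  obtain ⟨C, hC, h⟩ := exists_branchAmplitude_bound hp κ hK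
  have h1 : Tendsto (fun z : ℂ => C * ‖z⁻¹‖) (infinityWithin R) (𝓝 (C * ‖(0 : ℂ)‖)) :=
    ((tendsto_inv₀_cobounded (α := ℂ)).mono_left inf_le_left).norm.const_mul C
  rw [norm_zero, mul_zero] at h1
  refine squeeze_zero_norm' ?_ h1
  have hz1 : ∀ᶠ z in infinityWithin R, 1 ≤ ‖z‖ :=
    (tendsto_norm_cobounded_atTop.eventually_ge_atTop 1).filter_mono inf_le_left
  filter_upwards [hz1, mem_inf_of_right (mem_principal_self R)] with z hz hzR
  have h2 := (h z hz (hR z hzR)).2.1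
  rw [norm_mul, norm_pow] at h2
  rw [norm_inv, ← div_eq_mul_inv, le_div_iff₀ (by linarith)]
  refine le_trans ?_ h2
  rw [mul_comm]
  gcongr
  nlinarith

end Branch

/-! ### The solution regular at the origin. -/

/-- The integrals `∫ (i cos θ) ^ k e ^ (i z cos θ)` over `0 < θ < π`: the derivatives of `π J₀`. -/
noncomputable def besselIntegral (k : ℕ) (z : ℂ) : ℂ :=
  ∫ θ in (0 : ℝ)..Real.pi, (Complex.I * Real.cos θ) ^ k * Complex.exp (Complex.I * z * Real.cos θ)

theorem hasDerivAt_besselIntegral (k : ℕ) (z : ℂ) :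
    HasDerivAt (besselIntegral k) (besselIntegral (k + 1) z) z := by
  have hc : ∀ (k : ℕ) (z : ℂ), Continuous fun θ : ℝ =>
      (Complex.I * Real.cos θ) ^ k * Complex.exp (Complex.I * z * Real.cos θ) := by
    intro k z
    fun_prop
  refine (intervalIntegral.hasDerivAt_integral_of_dominated_loc_of_deriv_le
    (F := fun (z : ℂ) (θ : ℝ) =>
      (Complex.I * Real.cos θ) ^ k * Complex.exp (Complex.I * z * Real.cos θ))
    (F' := fun (z : ℂ) (θ : ℝ) =>
      (Complex.I * Real.cos θ) ^ (k + 1) * Complex.exp (Complex.I * z * Real.cos θ))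
    (bound := fun _ => Real.exp (‖z‖ + 1)) (Metric.ball_mem_nhds z one_pos)
    (Eventually.of_forall fun v => (hc k v).aestronglyMeasurable)
    ((hc k z).intervalIntegrable _ _) (hc (k + 1) z).aestronglyMeasurable
    (Eventually.of_forall fun θ _ v hv => ?_) intervalIntegrable_const
    (Eventually.of_forall fun θ _ v _ => ?_)).2
  · have h1 : ‖Complex.I * (Real.cos θ : ℂ)‖ ≤ 1 := by
      rw [norm_mul, Complex.norm_I, one_mul, Complex.norm_real]
      exact Real.abs_cos_le_one θ
    have h2 : ‖v‖ ≤ ‖z‖ + 1 := by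
      have := norm_le_norm_add_norm_sub' v z
      rw [mem_ball_iff_norm] at hv
      linarith
    have h3 : ‖Complex.I * v * (Real.cos θ : ℂ)‖ ≤ ‖v‖ := by
      rw [mul_right_comm, norm_mul]
      exact mul_le_of_le_one_left (norm_nonneg v) h1
    rw [norm_mul, norm_pow, Complex.norm_exp]
    refine (mul_le_of_le_one_left (Real.exp_pos _).le (pow_le_one₀ (norm_nonneg _) h1)).trans ?_
    exact Real.exp_le_exp.2 ((Complex.re_le_norm _).trans (h3.trans h2))
  · have d : HasDerivAt (fun v : ℂ => Complex.I * v * (Real.cos θ : ℂ))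
        (Complex.I * (Real.cos θ : ℂ)) v := by
      simpa using ((hasDerivAt_id v).const_mul Complex.I).mul_const (Real.cos θ : ℂ)
    refine (d.cexp.const_mul _).congr_deriv ?_
    ring

theorem besselIntegral_ode (z : ℂ) :
    z * besselIntegral 2 z + besselIntegral 1 z + z * besselIntegral 0 z = 0 := by
  have hc : ∀ k : ℕ, IntervalIntegrable (fun θ : ℝ =>
      (Complex.I * Real.cos θ) ^ k * Complex.exp (Complex.I * z * Real.cos θ)) volume 0 Real.pi :=
    fun k => Continuous.intervalIntegrable (by fun_prop) _ _
  -- Bessel's equation holds because its integrand is the derivative of `i sin θ e^(iz cos θ)`,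
  -- which vanishes at `0` and `π`.
  have hd : ∀ θ ∈ uIcc (0 : ℝ) Real.pi, HasDerivAt (fun θ : ℝ =>
      Complex.I * Real.sin θ * Complex.exp (Complex.I * z * Real.cos θ))
      (z * ((Complex.I * Real.cos θ) ^ 2 * Complex.exp (Complex.I * z * Real.cos θ)) +
        (Complex.I * Real.cos θ) ^ 1 * Complex.exp (Complex.I * z * Real.cos θ) +
        z * ((Complex.I * Real.cos θ) ^ 0 * Complex.exp (Complex.I * z * Real.cos θ))) θ := by
    intro θ _
    have d1 := (Real.hasDerivAt_sin θ).ofReal_comp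
    have d2 := (Real.hasDerivAt_cos θ).ofReal_comp
    refine ((d1.const_mul Complex.I).fun_mul (d2.const_mul (Complex.I * z)).cexp).congr_deriv ?_
    have h1 : ((Real.sin θ : ℂ)) ^ 2 = 1 - (Real.cos θ : ℂ) ^ 2 := by
      rw [← Complex.ofReal_pow, Real.sin_sq]
      push_cast
      ring
    push_cast at h1 ⊢
    linear_combination (z * Complex.exp (Complex.I * z * Complex.cos θ)) *
      (h1 - (Complex.sin θ ^ 2 + Complex.cos θ ^ 2) * Complex.I_sq)
  have h := intervalIntegral.integral_eq_sub_of_hasDerivAt hd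
    ((((hc 2).const_mul z).add (hc 1)).add ((hc 0).const_mul z))
  rw [intervalIntegral.integral_add (((hc 2).const_mul z).add (hc 1)) ((hc 0).const_mul z),
    intervalIntegral.integral_add ((hc 2).const_mul z) (hc 1),
    intervalIntegral.integral_const_mul, intervalIntegral.integral_const_mul] at h
  simpa [besselIntegral] using h

theorem besselIntegral_neg (z : ℂ) : besselIntegral 0 (-z) = besselIntegral 0 z := by
  have h := intervalIntegral.integral_comp_sub_left (a := 0) (b := Real.pi)
    (fun θ : ℝ => Complex.exp (Complex.I * z * Real.cos θ)) Real.pi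
  simp only [Real.cos_pi_sub, sub_self, sub_zero] at h
  simp only [besselIntegral, pow_zero, one_mul]
  rw [← h]
  refine intervalIntegral.integral_congr fun θ _ => ?_
  simp

/-- The complement of the closed negative imaginary axis. -/
def upperSlitPlane : Set ℂ := {z | 0 < z.im ∨ z.re ≠ 0}

theorem isOpen_upperSlitPlane : IsOpen upperSlitPlane :=
  (isOpen_lt continuous_const Complex.continuous_im).union
    (isOpen_ne_fun Complex.continuous_re continuous_const)

/-- The solution that is regular at the origin, a multiple of `√z J₀(z)`. -/
noncomputable def regularSolution (z : ℂ) : ℂ :=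
  (-Complex.I * z) ^ (1 / 2 : ℂ) * besselIntegral 0 z

theorem neg_I_mul_mem_slitPlane {z : ℂ} (hz : z ∈ upperSlitPlane) :
    -Complex.I * z ∈ Complex.slitPlane := by
  rw [Complex.mem_slitPlane_iff]
  simpa [upperSlitPlane] using hz

theorem isBesselSolutionOn_regularSolution : IsBesselSolutionOn upperSlitPlane regularSolution := by
  have ds : ∀ z ∈ upperSlitPlane, z ≠ 0 ∧ HasDerivAt (fun z => (-Complex.I * z) ^ (1 / 2 : ℂ))
      ((-Complex.I * z) ^ (1 / 2 : ℂ) / (2 * z)) z := by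
    intro z hz
    have hs := neg_I_mul_mem_slitPlane hz
    have hX := Complex.slitPlane_ne_zero hs
    have hz0 : z ≠ 0 := right_ne_zero_of_mul hX
    have d : HasDerivAt (fun z : ℂ => -Complex.I * z) (-Complex.I) z := by
      simpa using (hasDerivAt_id z).const_mul (-Complex.I)
    refine ⟨hz0, (d.cpow_const (c := 1 / 2) hs).congr_deriv ?_⟩
    rw [Complex.cpow_sub _ _ hX, Complex.cpow_one]
    generalize (-Complex.I * z) ^ (1 / 2 : ℂ) = Y
    have := Complex.I_ne_zero
    field_simp
  refine isBesselSolutionOn_of_hasDerivAt isOpen_upperSlitPlane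
    (fun z hz => (ds z hz).2.fun_mul (hasDerivAt_besselIntegral 0 z))
    (h₂ := fun z => (-Complex.I * z) ^ (1 / 2 : ℂ) *
      (besselIntegral 2 z + besselIntegral 1 z / z - besselIntegral 0 z / (4 * z ^ 2)))
    (fun z hz => ?_) (fun z hz => ?_)
  · obtain ⟨hz0, d⟩ := ds z hz
    have d2 : HasDerivAt (fun z : ℂ => 2 * z) 2 z := by simpa using (hasDerivAt_id z).const_mul 2
    refine (((d.fun_div d2 (by simpa using hz0)).fun_mul (hasDerivAt_besselIntegral 0 z)).fun_add
      (d.fun_mul (hasDerivAt_besselIntegral 1 z))).congr_deriv ?_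
    simp only [zero_add, Nat.reduceAdd]
    generalize (-Complex.I * z) ^ (1 / 2 : ℂ) = Y
    field_simp
    ring
  · have hz0 := (ds z hz).1
    rw [regularSolution]
    generalize (-Complex.I * z) ^ (1 / 2 : ℂ) = Y
    have h := besselIntegral_ode z
    field_simp
    linear_combination (4 * z * Y) * h

/-- The Bessel integral is even, so only the square root contributes: `Im(iz) = Re z < 0`, hence
passing from `iz` to `-iz` adds `π` to the argument and `e^(iπ/2) = i` to the root. -/
theorem regularSolution_neg {z : ℂ} (hz : z.re < 0) :
    regularSolution z = Complex.I * regularSolution (-z) := by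
  have h0 : Complex.I * z ≠ 0 := by
    refine mul_ne_zero Complex.I_ne_zero ?_
    rintro rfl
    simp at hz
  have hlog : Complex.log (-(Complex.I * z)) = Complex.log (Complex.I * z) + Real.pi * Complex.I := by
    apply Complex.ext
    · simp [Complex.log_re]
    · simp only [Complex.log_im, Complex.add_im, Complex.mul_im, Complex.ofReal_re, Complex.I_im,
        Complex.ofReal_im, Complex.I_re, mul_one, mul_zero, add_zero]
      exact Complex.arg_neg_eq_arg_add_pi_of_im_neg (by simpa using hz)
  rw [regularSolution, regularSolution, besselIntegral_neg, neg_mul, neg_mul_neg,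
    Complex.cpow_def_of_ne_zero h0, Complex.cpow_def_of_ne_zero (neg_ne_zero.2 h0), hlog, add_mul,
    Complex.exp_add]
  have : Complex.exp (Real.pi * Complex.I * (1 / 2)) = Complex.I := by
    rw [mul_one_div, mul_div_right_comm, Complex.exp_pi_div_two_mul_I]
  rw [this]
  ring

theorem exists_regularSolution_ne_zero : ∃ x : ℝ, 0 < x ∧ regularSolution x ≠ 0 := by
  have h0 : besselIntegral 0 ((0 : ℝ) : ℂ) ≠ 0 := by
    simp [besselIntegral, Real.pi_ne_zero]
  have hc : ContinuousAt (fun x : ℝ => besselIntegral 0 (x : ℂ)) 0 :=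
    ContinuousAt.comp (f := fun x : ℝ => (x : ℂ)) (hasDerivAt_besselIntegral 0 _).continuousAt
      Complex.continuous_ofReal.continuousAt
  have h1 : ∀ᶠ x : ℝ in 𝓝[>] 0, besselIntegral 0 (x : ℂ) ≠ 0 :=
    (hc.eventually_ne h0).filter_mono nhdsWithin_le_nhds
  obtain ⟨x, hx, hx0⟩ := (h1.and self_mem_nhdsWithin).exists
  have hx0' : (0 : ℝ) < x := hx0
  refine ⟨x, hx0, mul_ne_zero ?_ hx⟩
  simp [hx0'.ne']

/-! ### Domains of the branches and their Wronskians. -/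

/-- Cones and the slit plane are invariant under positive scaling, so membership of `c/(2z)` can be
tested on `c` times the conjugate of `z`, which is polynomial in the coordinates. -/
theorem div_two_mul_eq (c z : ℂ) :
    c / (2 * z) = ((1 / (2 * Complex.normSq z) : ℝ) : ℂ) * (c * (starRingEnd ℂ) z) := by
  rw [div_eq_mul_inv, mul_inv, Complex.inv_def z]
  push_cast
  ring

theorem div_two_mul_mem_obliqueCone {c z : ℂ} {K : ℝ}
    (h : c * (starRingEnd ℂ) z ∈ obliqueCone K) : c / (2 * z) ∈ obliqueCone K := by
  have h' : -(c * (starRingEnd ℂ) z).re ≤ K * |(c * (starRingEnd ℂ) z).im| := h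
  have hr : 0 ≤ 1 / (2 * Complex.normSq z) := by
    have := Complex.normSq_nonneg z
    positivity
  rw [div_two_mul_eq]
  simp only [obliqueCone, mem_ofPred_eq, Complex.re_ofReal_mul, Complex.im_ofReal_mul, abs_mul,
    abs_of_nonneg hr]
  nlinarith

theorem div_two_mul_mem_slitPlane {c z : ℂ} (hz : z ≠ 0)
    (h : c * (starRingEnd ℂ) z ∈ Complex.slitPlane) : c / (2 * z) ∈ Complex.slitPlane := by
  have hr : 0 < 1 / (2 * Complex.normSq z) := by
    have := Complex.normSq_pos.2 hz
    positivity
  rw [Complex.mem_slitPlane_iff] at h ⊢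
  rw [div_two_mul_eq, Complex.re_ofReal_mul, Complex.im_ofReal_mul]
  exact h.imp (fun h => mul_pos hr h) (fun h => mul_ne_zero hr.ne' h)

theorem upperSlitPlane_subset_branchDomain :
    upperSlitPlane ⊆ branchDomain Complex.I 1 := by
  intro z hz
  refine div_two_mul_mem_slitPlane ?_ ?_
  · rintro rfl
    simp [upperSlitPlane] at hz
  · rw [Complex.mem_slitPlane_iff]
    simpa [upperSlitPlane] using hz

theorem mem_branchDomain_neg_I_one {z : ℂ} (hz : z.re ≠ 0) :
    z ∈ branchDomain (-Complex.I) 1 := by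
  refine div_two_mul_mem_slitPlane ?_ ?_
  · rintro rfl
    simp at hz
  · rw [Complex.mem_slitPlane_iff]
    right
    simpa using hz

theorem mem_branchDomain_neg_I_one_add_I {z : ℂ} (hz : 0 < z.re + z.im) :
    z ∈ branchDomain (-Complex.I) (1 + Complex.I) := by
  refine div_two_mul_mem_slitPlane ?_ ?_
  · rintro rfl
    simp at hz
  · rw [Complex.mem_slitPlane_iff]
    right
    simp
    linarith

theorem besselBranch_neg (κ p z : ℂ) : besselBranch κ p (-z) = besselBranch (-κ) p z := by
  rw [besselBranch, besselBranch, branchAmplitude, branchAmplitude]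
  congr 2
  · ring_nf
  · congr 1
    rw [mul_neg, div_neg, neg_mul, neg_div]

theorem tendsto_ofReal_atTop_infinityWithin :
    Tendsto (fun x : ℝ => (x : ℂ)) atTop (infinityWithin {z | 0 < z.re ∧ z.im = 0}) := by
  refine tendsto_inf.2 ⟨?_, tendsto_principal.2 ?_⟩
  · rw [← tendsto_norm_atTop_iff_cobounded]
    simpa using tendsto_abs_atTop_atTop
  · filter_upwards [eventually_gt_atTop 0] with x hx
    simpa using hx

theorem mul_div_two_mul_mem_obliqueCone_of_pos {κ p z : ℂ} (hκp : 0 ≤ (κ * p).re)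
    (hz : z ∈ {z : ℂ | 0 < z.re ∧ z.im = 0}) : κ * p / (2 * z) ∈ obliqueCone 0 := by
  obtain ⟨h1, h2⟩ := hz
  refine div_two_mul_mem_obliqueCone ?_
  simp only [obliqueCone, mem_ofPred_eq, zero_mul, Complex.mul_re (κ * p), Complex.conj_re,
    Complex.conj_im, h2, neg_zero, mul_zero, sub_zero, Left.neg_nonpos_iff]
  exact mul_nonneg hκp h1.le

theorem tendsto_besselBranch_wronskian {κ κ' p p' : ℂ} (hp : 0 < p.re) (hp' : 0 < p'.re)
    (h : 0 ≤ (κ * p).re) (h' : 0 ≤ (κ' * p').re) :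
    Tendsto (fun x : ℝ => branchAmplitude κ p x *
      (branchAmplitudeDeriv κ' p' x + κ' * branchAmplitude κ' p' x) -
        (branchAmplitudeDeriv κ p x + κ * branchAmplitude κ p x) * branchAmplitude κ' p' x)
      atTop (𝓝 (κ' - κ)) := by
  have t := tendsto_ofReal_atTop_infinityWithin
  have a := (tendsto_branchAmplitude hp le_rfl
    (fun z hz => mul_div_two_mul_mem_obliqueCone_of_pos h hz)).comp t
  have a' := (tendsto_branchAmplitude hp' le_rfl
    (fun z hz => mul_div_two_mul_mem_obliqueCone_of_pos h' hz)).comp t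
  have b := (tendsto_branchAmplitudeDeriv hp le_rfl
    (fun z hz => mul_div_two_mul_mem_obliqueCone_of_pos h hz)).comp t
  have b' := (tendsto_branchAmplitudeDeriv hp' le_rfl
    (fun z hz => mul_div_two_mul_mem_obliqueCone_of_pos h' hz)).comp t
  have := (a.mul (b'.add (a'.const_mul κ'))).sub ((b.add (a.const_mul κ)).mul a')
  simpa using this

/-- The Wronskian of two branches on a connected set reaching `+∞`. -/
theorem wronskian_besselBranch_eq {κ κ' p p' : ℂ} (hp : 0 < p.re) (hp' : 0 < p'.re)
    (hκ : κ ^ 2 = -1) (hκ' : κ' ^ 2 = -1) (hre : (κ + κ').re = 0)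
    (h : 0 ≤ (κ * p).re) (h' : 0 ≤ (κ' * p').re) (hcase : κ' = κ ∨ κ + κ' = 0) {U : Set ℂ}
    (hU : IsOpen U) (hc : IsPreconnected U) (hUx : ∀ x : ℝ, 0 < x → (x : ℂ) ∈ U)
    (hd : U ⊆ branchDomain κ p) (hd' : U ⊆ branchDomain κ' p') {z : ℂ} (hz : z ∈ U) :
    wronskian (besselBranch κ p) (besselBranch κ' p') z = κ' - κ := by
  have hf := (isBesselSolutionOn_besselBranch hκ hp).mono hd
  have hg := (isBesselSolutionOn_besselBranch hκ' hp').mono hd'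
  have t := tendsto_besselBranch_wronskian hp hp' h h'
  have e : ∀ᶠ x : ℝ in atTop, wronskian (besselBranch κ p) (besselBranch κ' p') z =
      Complex.exp ((κ + κ') * x) * (branchAmplitude κ p x *
      (branchAmplitudeDeriv κ' p' x + κ' * branchAmplitude κ' p' x) -
        (branchAmplitudeDeriv κ p x + κ * branchAmplitude κ p x) * branchAmplitude κ' p' x) := by
    filter_upwards [eventually_gt_atTop 0] with x hx
    rw [wronskian_eq_of_isBesselSolutionOn hU hc hf hg hz (hUx x hx),
      wronskian_besselBranch hp hp' (hd (hUx x hx)) (hd' (hUx x hx))]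
  rcases hcase with rfl | hs
  · rw [sub_self] at t ⊢
    -- For equal exponents the factor `e^(2κx)` oscillates, so the limit is taken after passing to
    -- norms, where this factor is 1.
    rw [← norm_eq_zero, ← norm_zero (E := ℂ)]
    refine tendsto_nhds_unique (tendsto_const_nhds.congr' ?_) t.norm
    filter_upwards [e] with x hx
    rw [hx, norm_mul, Complex.norm_exp, Complex.re_mul_ofReal, hre, zero_mul, Real.exp_zero,
      one_mul]
  · simp only [hs, zero_mul, Complex.exp_zero, one_mul] at e
    exact tendsto_nhds_unique (tendsto_const_nhds.congr' e) t

/-! ### The connection formula and the Stokes constant. -/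

theorem exists_besselConnection :
    ∃ a : ℂ, a ≠ 0 ∧
      (∀ z : ℂ, 0 < z.re → regularSolution z =
        a * besselBranch Complex.I 1 z + Complex.I * a * besselBranch (-Complex.I) 1 z) ∧
      (∀ z : ℂ, z.re < 0 → regularSolution z =
        Complex.I * a * besselBranch (-Complex.I) 1 z - a * besselBranch Complex.I 1 z) ∧
      (∀ z : ℂ, 0 < z.re + z.im → regularSolution z = a * besselBranch Complex.I 1 z +
        Complex.I * a * besselBranch (-Complex.I) (1 + Complex.I) z) := by
  set P := besselBranch Complex.I 1 with hP
  set K := besselBranch (-Complex.I) 1 with hK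
  set Q := besselBranch (-Complex.I) (1 + Complex.I) with hQ
  set J := regularSolution with hJ
  have hI : Complex.I ^ 2 = -1 := Complex.I_sq
  have hI' : (-Complex.I) ^ 2 = -1 := by rw [neg_sq, hI]
  have h1 : 0 < (1 : ℂ).re := by simp
  have h2 : 0 < (1 + Complex.I : ℂ).re := by simp
  set R : Set ℂ := {z | 0 < z.re} with hR
  set S : Set ℂ := {z | 0 < z.re + z.im} with hS
  have oR : IsOpen R := isOpen_lt continuous_const Complex.continuous_re
  have oS : IsOpen S := isOpen_lt continuous_const (Complex.continuous_re.add Complex.continuous_im)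
  have cR : Convex ℝ R := convex_halfSpace_re_gt 0
  have cS : Convex ℝ S :=
    convex_halfSpace_gt (f := fun z : ℂ => z.re + z.im) (Complex.reLm + Complex.imLm).isLinear 0
  have RU : R ⊆ upperSlitPlane := fun z hz => Or.inr (ne_of_gt hz)
  have SU : S ⊆ upperSlitPlane := fun z hz => by
    by_contra hc
    simp only [upperSlitPlane, mem_ofPred_eq, not_or, not_not, not_lt] at hc
    have : 0 < z.re + z.im := hz
    linarith
  have sP : IsBesselSolutionOn upperSlitPlane P :=
    (isBesselSolutionOn_besselBranch hI h1).mono upperSlitPlane_subset_branchDomain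
  have sK : IsBesselSolutionOn R K := (isBesselSolutionOn_besselBranch hI' h1).mono
    fun z hz => mem_branchDomain_neg_I_one (ne_of_gt hz)
  have sQ : IsBesselSolutionOn S Q := (isBesselSolutionOn_besselBranch hI' h2).mono
    fun z hz => mem_branchDomain_neg_I_one_add_I hz
  have sJ : IsBesselSolutionOn upperSlitPlane J := isBesselSolutionOn_regularSolution
  have wPK : ∀ z ∈ R, wronskian P K z = -2 * Complex.I := fun z hz => by
    rw [hP, hK, wronskian_besselBranch_eq h1 h1 hI hI' (by simp) (by simp) (by simp) (by simp) oR
      cR.isPreconnected (fun x hx => by simpa [hR] using hx)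
      (RU.trans upperSlitPlane_subset_branchDomain)
      (fun z hz => mem_branchDomain_neg_I_one (ne_of_gt hz)) hz]
    ring
  have oneR : (1 : ℂ) ∈ R := by simp [hR]
  have oneS : (1 : ℂ) ∈ S := by simp [hS]
  have hne : (-2 * Complex.I : ℂ) ≠ 0 := by simp
  -- Rotating the ray of integration does not change the function. Instead of a contour shift,
  -- Wronskians determine the coefficients of `Q` in the basis `P`, `K`: they are 0 and 1.
  have QK : ∀ z ∈ R ∩ S, Q z = K z := fun z hz => by
    have c := (cR.inter cS).isPreconnected
    have o := oR.inter oS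
    have w1 : wronskian Q K 1 = 0 := by
      rw [hQ, hK, wronskian_besselBranch_eq h2 h1 hI' hI' (by simp) (by simp) (by simp) (by simp) o
        c (fun x hx => by simpa [hR, hS] using hx)
        (fun z hz => mem_branchDomain_neg_I_one_add_I hz.2)
        (fun z hz => mem_branchDomain_neg_I_one (ne_of_gt hz.1)) ⟨oneR, oneS⟩]
      ring
    have w2 : wronskian P Q 1 = -2 * Complex.I := by
      rw [hP, hQ, wronskian_besselBranch_eq h1 h2 hI hI' (by simp) (by simp) (by simp) (by simp) oS
        cS.isPreconnected (fun x hx => by simpa [hS] using hx)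
        (SU.trans upperSlitPlane_subset_branchDomain)
        (fun z hz => mem_branchDomain_neg_I_one_add_I hz) oneS]
      ring
    have := (sP.mono (inter_subset_left.trans RU)).eq_combination o c (sK.mono inter_subset_left)
      (sQ.mono inter_subset_right) (v := 1) ⟨oneR, oneS⟩ (by rw [wPK 1 oneR]; exact hne) hz
    rw [this, w1, w2, wPK 1 oneR, div_self hne]
    ring
  have eQK : Q =ᶠ[𝓝 1] K := by
    filter_upwards [(oR.inter oS).mem_nhds ⟨oneR, oneS⟩] with z hz using QK z hz
  have wPQ : wronskian P Q 1 = -2 * Complex.I := by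
    rw [← wPK 1 oneR, wronskian, wronskian, eQK.deriv_eq, eQK.eq_of_nhds]
  have wJQ : wronskian J Q 1 = wronskian J K 1 := by
    rw [wronskian, wronskian, eQK.deriv_eq, eQK.eq_of_nhds]
  set α := wronskian J K 1 / (-2 * Complex.I) with hα
  set β := wronskian P J 1 / (-2 * Complex.I) with hβ
  have JR : ∀ z ∈ R, J z = α * P z + β * K z := fun z hz => by
    rw [(sP.mono RU).eq_combination oR cR.isPreconnected sK (sJ.mono RU) oneR
      (by rw [wPK 1 oneR]; exact hne) hz, wPK 1 oneR]
  have JS : ∀ z ∈ S, J z = α * P z + β * Q z := fun z hz => by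
    rw [(sP.mono SU).eq_combination oS cS.isPreconnected sQ (sJ.mono SU) oneS
      (by rw [wPQ]; exact hne) hz, wPQ, wJQ]
  have negP : ∀ z, P (-z) = K z := fun z => besselBranch_neg _ _ z
  have negK : ∀ z, K (-z) = P z := fun z => by rw [hK, besselBranch_neg, neg_neg]
  have JL : ∀ z : ℂ, z.re < 0 → J z = Complex.I * β * P z + Complex.I * α * K z := fun z hz => by
    rw [hJ, regularSolution_neg hz, ← hJ, JR (-z) (by simpa [hR] using hz), negP, negK]
    ring
  -- The Wronskian of `P` and `J` is evaluated at two points of `S`: at 1 it is `β` times `-2i`, at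
  -- `v` in the left half-plane it is `iα` times `-2i`.
  have βα : β = Complex.I * α := by
    set v : ℂ := -1 + 2 * Complex.I with hv
    have vre : v.re = -1 := by simp [hv]
    have vim : v.im = 2 := by simp [hv]
    have vS : v ∈ S := by simp only [hS, mem_ofPred_eq, vre, vim]; norm_num
    have w1 : wronskian P J v = wronskian P J 1 :=
      wronskian_eq_of_isBesselSolutionOn oS cS.isPreconnected (sP.mono SU) (sJ.mono SU) vS oneS
    have hmv : v ∈ branchDomain (-Complex.I) 1 := mem_branchDomain_neg_I_one (by rw [vre]; norm_num)
    have sK' := isBesselSolutionOn_besselBranch (κ := -Complex.I) hI' h1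
    have eJ : J =ᶠ[𝓝 v] fun z => Complex.I * β * P z + Complex.I * α * K z := by
      filter_upwards [(isOpen_lt Complex.continuous_re continuous_const).mem_nhds
        (show v.re < 0 by rw [vre]; norm_num)] with z hz using JL z hz
    have dJ : deriv J v = Complex.I * β * deriv P v + Complex.I * α * deriv K v := by
      rw [eJ.deriv_eq]
      exact (((sP.hasDerivAt (SU vS)).const_mul _).fun_add ((sK'.hasDerivAt hmv).const_mul _)).deriv
    have w2 : wronskian P K v = -2 * Complex.I := by
      rw [← wPK (-v) (by simp [hR, vre])]
      have d1 : deriv P (-v) = -deriv K v := by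
        have : (fun z => P (-z)) = K := funext negP
        rw [← this, deriv_comp_neg, neg_neg]
      have d2 : deriv K (-v) = -deriv P v := by
        have : (fun z => K (-z)) = P := funext negK
        rw [← this, deriv_comp_neg, neg_neg]
      rw [wronskian, wronskian, d1, d2, negP, negK]
      ring
    have w3 : wronskian P J v = Complex.I * α * wronskian P K v := by
      rw [wronskian, wronskian, dJ, eJ.eq_of_nhds]
      ring
    rw [hβ, ← w1, w3, w2, mul_div_cancel_right₀ _ hne]
  rw [βα] at JR JL JS
  refine ⟨α, ?_, JR, fun z hz => ?_, JS⟩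
  -- If the coefficient vanished, so would `J` on the positive axis, contradicting its nonzero
  -- values near the origin.
  · rintro h0
    obtain ⟨x, hx, hx0⟩ := exists_regularSolution_ne_zero
    refine hx0 ?_
    rw [← hJ, JR x (by simpa [hR] using hx), h0]
    simp
  · rw [JL z hz]
    linear_combination α * P z * hI

theorem exists_dominantBranch :
    ∃ h : ℂ → ℂ, IsBesselSolutionOn upperSlitPlane h ∧
      (∀ z : ℂ, 0 < z.re + z.im → h z = besselBranch (-Complex.I) (1 + Complex.I) z) ∧
      (∀ z : ℂ, z.re < 0 → h z =
        besselBranch (-Complex.I) 1 z + 2 * Complex.I * besselBranch Complex.I 1 z) := by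
  obtain ⟨a, ha, -, hL, hS⟩ := exists_besselConnection
  have sP : IsBesselSolutionOn upperSlitPlane (besselBranch Complex.I 1) :=
    (isBesselSolutionOn_besselBranch Complex.I_sq (by simp)).mono upperSlitPlane_subset_branchDomain
  have hI := Complex.I_ne_zero
  -- Solving `J = aP + iaQ` for `Q` gives `Q = J/(ia) + iP`, and the right side is defined on the
  -- whole slit plane. Inserting the left-hand formula for `J` produces the two contributions `iP +
  -- iP`.
  refine ⟨_, isBesselSolutionOn_regularSolution.linear_combination sP isOpen_upperSlitPlane
    (Complex.I * a)⁻¹ Complex.I, fun z hz => ?_, fun z hz => ?_⟩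
  · simp only [hS z hz]
    field_simp
    linear_combination besselBranch Complex.I 1 z * Complex.I_sq
  · simp only [hL z hz]
    field_simp
    linear_combination -(besselBranch Complex.I 1 z) * Complex.I_sq

/-! ### Uniform cones in the two parts of the upper half-plane. -/

/-- The part of the closed upper half-plane outside the unit disc that lies to the right of the
line `Re z = -Im z / 2`. -/
def rightRegion : Set ℂ := {z | 0 ≤ z.im ∧ 1 ≤ ‖z‖ ∧ -z.im ≤ 2 * z.re}

/-- The part of the closed upper half-plane outside the unit disc that lies to the left of the
line `Re z = -Im z / 2`. -/
def leftRegion : Set ℂ := {z | 0 ≤ z.im ∧ 1 ≤ ‖z‖ ∧ 2 * z.re ≤ -z.im}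

theorem one_le_norm_ne_zero {z : ℂ} (hz : 1 ≤ ‖z‖) : z ≠ 0 := by
  rintro rfl
  norm_num at hz

theorem mem_upperSlitPlane_of_im_nonneg {z : ℂ} (hz : 0 ≤ z.im) (hz0 : z ≠ 0) :
    z ∈ upperSlitPlane := by
  by_contra hc
  simp only [upperSlitPlane, mem_ofPred_eq, not_or, not_not, not_lt] at hc
  exact hz0 (Complex.ext hc.2 (le_antisymm hc.1 hz))

theorem re_add_im_pos_of_mem_rightRegion {z : ℂ} (hz : z ∈ rightRegion) : 0 < z.re + z.im := by
  obtain ⟨h1, h2, h3⟩ := hz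
  by_contra hc
  exact one_le_norm_ne_zero h2 (Complex.ext (by simp; linarith) (by simp; linarith))

theorem re_neg_of_mem_leftRegion {z : ℂ} (hz : z ∈ leftRegion) : z.re < 0 := by
  obtain ⟨h1, h2, h3⟩ := hz
  by_contra hc
  exact one_le_norm_ne_zero h2 (Complex.ext (by simp; linarith) (by simp; linarith))

theorem mem_obliqueCone_of_im_nonneg {z : ℂ} (hz : 0 ≤ z.im) :
    Complex.I * 1 / (2 * z) ∈ obliqueCone 3 := by
  refine div_two_mul_mem_obliqueCone ?_
  simp [obliqueCone]
  linarith [abs_nonneg z.re]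

/-- The cone constant 3 corresponds exactly to the dividing line `Re z = -Im z / 2`, which lies
strictly between the cut of `Q` and that of `K`. -/
theorem mem_obliqueCone_of_mem_rightRegion {z : ℂ} (hz : z ∈ rightRegion) :
    -Complex.I * (1 + Complex.I) / (2 * z) ∈ obliqueCone 3 := by
  have h := re_add_im_pos_of_mem_rightRegion hz
  obtain ⟨h1, h2, h3⟩ := hz
  refine div_two_mul_mem_obliqueCone ?_
  have e : -Complex.I * (1 + Complex.I) = 1 - Complex.I := by
    linear_combination -Complex.I_sq
  rw [e]
  simp [obliqueCone]
  rw [abs_of_neg] <;> linarith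

theorem mem_obliqueCone_of_mem_leftRegion {z : ℂ} (hz : z ∈ leftRegion) :
    -Complex.I * 1 / (2 * z) ∈ obliqueCone 3 := by
  have h := re_neg_of_mem_leftRegion hz
  obtain ⟨h1, h2, h3⟩ := hz
  refine div_two_mul_mem_obliqueCone ?_
  simp [obliqueCone]
  rw [abs_of_neg h]
  linarith

/-! ### Asymptotics and estimates in the upper half-plane. -/

/-- The properties of the recessive branch `hp` and the dominant branch `hm` in the half-plane
`ε * Im z > 0`. -/
def IsBesselBranchPair (ε : ℝ) (hp hm : ℂ → ℂ) : Prop :=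
  IsBesselFundamentalSystemOn (openHalfPlane ε) hp hm ∧
  IsBesselSolutionOn (puncturedClosedHalfPlane ε) hp ∧
  IsBesselSolutionOn (puncturedClosedHalfPlane ε) hm ∧
  (hp ~[infinityWithin (exteriorRegion ε)] fun z => Complex.exp (ε * Complex.I * z)) ∧
  (∃ C : ℝ, ∀ z ∈ exteriorRegion ε,
    ‖Complex.exp (-(ε * Complex.I * z)) * hp z‖ ≤ C ∧
    ‖z ^ 2 * deriv (fun w => Complex.exp (-(ε * Complex.I * w)) * hp w) z‖ ≤ C ∧
    ‖z ^ 3 * deriv (deriv (fun w => Complex.exp (-(ε * Complex.I * w)) * hp w)) z‖ ≤ C) ∧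
  (∀ δ ∈ Set.Ioo (0 : ℝ) 1,
    hm ~[infinityWithin (sectorRegion ε δ)] fun z => Complex.exp (-(ε * Complex.I * z))) ∧
  (∃ C : ℝ, ∀ δ ∈ Set.Ioo (0 : ℝ) 1, ∀ z ∈ sectorRegion ε δ,
    ‖Complex.exp (ε * Complex.I * z) * hm z‖ ≤ C ∧
    ‖Complex.exp (ε * Complex.I * z) * deriv hm z‖ ≤ C) ∧
  (∀ δ ∈ Set.Ioo (0 : ℝ) 1, ∃ C : ℝ, ∀ z ∈ sectorRegion ε δ,
    ‖z ^ 2 * deriv (fun w => Complex.exp (ε * Complex.I * w) * hm w) z‖ ≤ C) ∧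
  (∀ C : ℝ → ℝ,
    (∀ δ ∈ Set.Ioo (0 : ℝ) 1, ∀ z ∈ sectorRegion ε δ,
      ‖z ^ 2 * deriv (fun w => Complex.exp (ε * Complex.I * w) * hm w) z‖ ≤ C δ) →
    Tendsto C (𝓝[>] 0) atTop) ∧
  ((fun x : ℝ => hm x) ~[atBot] fun x : ℝ =>
    Complex.exp (-(ε * Complex.I * x)) + 2 * (ε * Complex.I) * Complex.exp (ε * Complex.I * x))

theorem isEquivalent_exp_of_tendsto {l : Filter ℂ} {h u : ℂ → ℂ}
    (hl : Tendsto (fun z => Complex.exp (-u z) * h z) l (𝓝 1)) :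
    h ~[l] fun z => Complex.exp (u z) := by
  refine isEquivalent_of_tendsto_one (hl.congr fun z => ?_)
  simp only [Pi.div_apply, Complex.exp_neg]
  ring

theorem norm_exp_I_mul (z : ℂ) (r : ℝ) : ‖Complex.exp (r * Complex.I * z)‖ = Real.exp (-(r * z.im)) := by
  rw [Complex.norm_exp]
  congr 1
  simp

theorem norm_le_of_mem_sector {z : ℂ} {δ : ℝ} (hδ : 0 < δ) (h0 : 0 ≤ z.im)
    (hL : z.re < 0) (h : -δ * z.re ≤ z.im) : ‖z‖ ≤ (1 + δ⁻¹) * z.im := by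
  have h1 := Complex.norm_le_abs_re_add_abs_im z
  rw [abs_of_nonneg h0, abs_of_neg hL] at h1
  have h2 : -z.re ≤ δ⁻¹ * z.im := by
    rw [inv_mul_eq_div, le_div_iff₀ hδ]
    linarith
  linarith

section Amplitude

variable {h : ℂ → ℂ}

theorem exp_mul_dominant_right
    (hS : ∀ z : ℂ, 0 < z.re + z.im → h z = besselBranch (-Complex.I) (1 + Complex.I) z)
    {z : ℂ} (hz : 0 < z.re + z.im) :
    Complex.exp (Complex.I * z) * h z = branchAmplitude (-Complex.I) (1 + Complex.I) z := by
  rw [hS z hz, besselBranch, ← mul_assoc, ← Complex.exp_add]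
  simp

theorem exp_mul_dominant_left
    (hL : ∀ z : ℂ, z.re < 0 → h z =
        besselBranch (-Complex.I) 1 z + 2 * Complex.I * besselBranch Complex.I 1 z)
    {z : ℂ} (hz : z.re < 0) :
    Complex.exp (Complex.I * z) * h z = branchAmplitude (-Complex.I) 1 z +
      2 * Complex.I * (Complex.exp (2 * Complex.I * z) * branchAmplitude Complex.I 1 z) := by
  have e1 : Complex.exp (Complex.I * z) * Complex.exp (-Complex.I * z) = 1 := by
    rw [← Complex.exp_add]
    simp
  have e2 : Complex.exp (2 * Complex.I * z) =
      Complex.exp (Complex.I * z) * Complex.exp (Complex.I * z) := by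
    rw [← Complex.exp_add]
    ring_nf
  rw [hL z hz, besselBranch, besselBranch, e2]
  linear_combination branchAmplitude (-Complex.I) 1 z * e1

theorem deriv_exp_mul_dominant_right
    (hS : ∀ z : ℂ, 0 < z.re + z.im → h z = besselBranch (-Complex.I) (1 + Complex.I) z)
    {z : ℂ} (hz : 0 < z.re + z.im) :
    deriv (fun w => Complex.exp (Complex.I * w) * h w) z =
      branchAmplitudeDeriv (-Complex.I) (1 + Complex.I) z := by
  have e : (fun w => Complex.exp (Complex.I * w) * h w) =ᶠ[𝓝 z]
      branchAmplitude (-Complex.I) (1 + Complex.I) := by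
    filter_upwards [(isOpen_lt continuous_const
      (Complex.continuous_re.add Complex.continuous_im)).mem_nhds hz] with w hw
    exact exp_mul_dominant_right hS hw
  rw [e.deriv_eq]
  exact (hasDerivAt_branchAmplitude (by simp) (mem_branchDomain_neg_I_one_add_I hz)).deriv

theorem deriv_exp_mul_dominant_left
    (hL : ∀ z : ℂ, z.re < 0 → h z =
        besselBranch (-Complex.I) 1 z + 2 * Complex.I * besselBranch Complex.I 1 z)
    {z : ℂ} (hz : z.re < 0) :
    deriv (fun w => Complex.exp (Complex.I * w) * h w) z = branchAmplitudeDeriv (-Complex.I) 1 z +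
      2 * Complex.I * (Complex.exp (2 * Complex.I * z) *
        (branchAmplitudeDeriv Complex.I 1 z + 2 * Complex.I * branchAmplitude Complex.I 1 z)) := by
  have e : (fun w => Complex.exp (Complex.I * w) * h w) =ᶠ[𝓝 z] fun w =>
      branchAmplitude (-Complex.I) 1 w +
      2 * Complex.I * (Complex.exp (2 * Complex.I * w) * branchAmplitude Complex.I 1 w) := by
    filter_upwards [(isOpen_lt Complex.continuous_re continuous_const).mem_nhds hz] with w hw
    exact exp_mul_dominant_left hL hw
  rw [e.deriv_eq]
  have d : HasDerivAt (fun w : ℂ => 2 * Complex.I * w) (2 * Complex.I) z := by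
    simpa using (hasDerivAt_id z).const_mul (2 * Complex.I)
  have d1 := hasDerivAt_branchAmplitude (p := 1) (by simp) (mem_branchDomain_neg_I_one hz.ne)
  have d2 := hasDerivAt_branchAmplitude (p := 1) (by simp)
    (upperSlitPlane_subset_branchDomain (Or.inr hz.ne))
  refine ((d1.fun_add ((d.cexp.fun_mul d2).const_mul (2 * Complex.I)))).deriv.trans ?_
  ring

end Amplitude

theorem exists_isBesselBranchPair_one : ∃ hp hm : ℂ → ℂ, IsBesselBranchPair 1 hp hm := by
  obtain ⟨h, sh, hS, hL⟩ := exists_dominantBranch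
  have h1 : 0 < (1 : ℂ).re := by simp
  have h2 : 0 < (1 + Complex.I : ℂ).re := by simp
  have sP : IsBesselSolutionOn upperSlitPlane (besselBranch Complex.I 1) :=
    (isBesselSolutionOn_besselBranch Complex.I_sq h1).mono upperSlitPlane_subset_branchDomain
  have closed_sub : puncturedClosedHalfPlane 1 ⊆ upperSlitPlane := fun z hz =>
    mem_upperSlitPlane_of_im_nonneg (by simpa using hz.1) hz.2
  have open_sub : openHalfPlane 1 ⊆ upperSlitPlane := fun z hz => Or.inl (by simpa [openHalfPlane] using hz)
  have amp : (fun w => Complex.exp (-(Complex.I * w)) * besselBranch Complex.I 1 w) =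
      branchAmplitude Complex.I 1 := by
    funext w
    rw [besselBranch, ← mul_assoc, ← Complex.exp_add]
    simp
  obtain ⟨CP, hCP, bP⟩ := exists_branchAmplitude_bound h1 Complex.I (K := 3) (by norm_num)
  obtain ⟨CK, hCK, bK⟩ := exists_branchAmplitude_bound h1 (-Complex.I) (K := 3) (by norm_num)
  obtain ⟨CQ, hCQ, bQ⟩ := exists_branchAmplitude_bound h2 (-Complex.I) (K := 3) (by norm_num)
  have deriv_le : ∀ {z d : ℂ} {C : ℝ}, 1 ≤ ‖z‖ → ‖z ^ 2 * d‖ ≤ C → ‖d‖ ≤ C := by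
    intro z d C hz hd
    rw [norm_mul, norm_pow] at hd
    exact (le_mul_of_one_le_left (norm_nonneg d) (one_le_pow₀ hz)).trans hd
  have normI : ∀ c : ℂ, ‖2 * Complex.I * c‖ = 2 * ‖c‖ := fun c => by simp
  have normE : ∀ z : ℂ, ‖Complex.exp (2 * Complex.I * z)‖ = Real.exp (-(2 * z.im)) := fun z => by
    simpa using norm_exp_I_mul z 2
  have normE_le : ∀ z : ℂ, 0 ≤ z.im → ‖Complex.exp (2 * Complex.I * z)‖ ≤ 1 := fun z hz => by
    rw [normE, Real.exp_le_one_iff]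
    linarith
  have cases_region : ∀ z : ℂ, 0 ≤ z.im → 1 ≤ ‖z‖ → z ∈ rightRegion ∨ z ∈ leftRegion := by
    intro z h0 hz
    rcases le_total (-z.im) (2 * z.re) with hr | hr
    · exact Or.inl ⟨h0, hz, hr⟩
    · exact Or.inr ⟨h0, hz, hr⟩
  have neg_mem : ∀ x : ℝ, x ≤ -1 → (x : ℂ) ∈ leftRegion := fun x hx => by
    refine ⟨by simp, ?_, by simp; linarith⟩
    rw [Complex.norm_real, Real.norm_eq_abs, abs_of_neg] <;> linarith
  have tneg : Tendsto (fun x : ℝ => (x : ℂ)) atBot (infinityWithin leftRegion) := by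
    refine tendsto_inf.2 ⟨?_, tendsto_principal.2 ?_⟩
    · rw [← tendsto_norm_atTop_iff_cobounded]
      simpa using tendsto_abs_atBot_atTop
    · filter_upwards [eventually_le_atBot (-1)] with x hx using neg_mem x hx
  have tP : Tendsto (fun x : ℝ => branchAmplitude Complex.I 1 x) atBot (𝓝 1) :=
    (tendsto_branchAmplitude h1 (κ := Complex.I) (K := 3) (by norm_num)
      fun z hz => mem_obliqueCone_of_im_nonneg hz.1).comp tneg
  have nE1 : ∀ x : ℝ, ‖Complex.exp (-(Complex.I * x))‖ = 1 := fun x => by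
    simp [Complex.norm_exp]
  have nE2 : ∀ x : ℝ, ‖Complex.exp (Complex.I * x)‖ = 1 := fun x => by
    simp [Complex.norm_exp]
  refine ⟨besselBranch Complex.I 1, h, ?_, sP.mono closed_sub, sh.mono closed_sub, ?_, ?_, ?_, ?_,
    ?_, ?_, ?_⟩
  · have hU : IsOpen (openHalfPlane 1) := by
      simpa [openHalfPlane] using isOpen_lt continuous_const Complex.continuous_im
    have hc : IsPreconnected (openHalfPlane 1) := by
      simpa [openHalfPlane] using (convex_halfSpace_im_gt 0).isPreconnected
    refine isBesselFundamentalSystemOn_of_wronskian_ne_zero hU hc (sP.mono open_sub)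
      (sh.mono open_sub) (v := Complex.I) (by simp [openHalfPlane]) ?_
    have hIS : 0 < Complex.I.re + Complex.I.im := by simp
    have oS : IsOpen {z : ℂ | 0 < z.re + z.im} :=
      isOpen_lt continuous_const (Complex.continuous_re.add Complex.continuous_im)
    have cS : Convex ℝ {z : ℂ | 0 < z.re + z.im} :=
      convex_halfSpace_gt (f := fun z : ℂ => z.re + z.im) (Complex.reLm + Complex.imLm).isLinear 0
    have e : h =ᶠ[𝓝 Complex.I] besselBranch (-Complex.I) (1 + Complex.I) := by
      filter_upwards [oS.mem_nhds hIS] with z hz using hS z hz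
    have e' : wronskian (besselBranch Complex.I 1) h Complex.I = wronskian (besselBranch Complex.I 1)
        (besselBranch (-Complex.I) (1 + Complex.I)) Complex.I := by
      rw [wronskian, wronskian, e.deriv_eq, e.eq_of_nhds]
    rw [e', wronskian_besselBranch_eq h1 h2 Complex.I_sq (by rw [neg_sq, Complex.I_sq]) (by simp)
      (by simp) (by simp) (by simp) oS cS.isPreconnected (fun x hx => by simpa using hx)
      (fun z hz => upperSlitPlane_subset_branchDomain ?_)
      (fun z hz => mem_branchDomain_neg_I_one_add_I hz) hIS, ← neg_add', ← two_mul]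
    · simp
    · by_contra hn
      simp only [upperSlitPlane, mem_ofPred_eq, not_or, not_not, not_lt] at hn
      have : 0 < z.re + z.im := hz
      linarith
  · refine isEquivalent_exp_of_tendsto ?_
    simp only [Complex.ofReal_one, one_mul, amp]
    exact tendsto_branchAmplitude h1 (K := 3) (by norm_num) fun z hz =>
      mem_obliqueCone_of_im_nonneg (by simpa using hz.1)
  · refine ⟨CP, fun z hz => ?_⟩
    have hz0 : 0 ≤ z.im := by simpa using hz.1
    have hzD : z ∈ branchDomain Complex.I 1 := upperSlitPlane_subset_branchDomain
      (mem_upperSlitPlane_of_im_nonneg hz0 (one_le_norm_ne_zero hz.2))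
    have e1 : deriv (branchAmplitude Complex.I 1) =ᶠ[𝓝 z] branchAmplitudeDeriv Complex.I 1 := by
      filter_upwards [(isOpen_branchDomain Complex.I 1).mem_nhds hzD] with w hw
      exact (hasDerivAt_branchAmplitude h1 hw).deriv
    have e0 := congrFun amp z
    simp only [Complex.ofReal_one, one_mul, amp, e0]
    rw [e1.deriv_eq, e1.eq_of_nhds, (hasDerivAt_branchAmplitudeDeriv h1 hzD).deriv]
    exact bP z hz.2 (mem_obliqueCone_of_im_nonneg hz0)
  · rintro δ ⟨hδ, -⟩
    refine isEquivalent_exp_of_tendsto ?_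
    simp only [Complex.ofReal_one, one_mul, neg_neg]
    -- Only in the left part does the Stokes term appear, and there the sector condition must be
    -- kept to make it decay.
    have hle : infinityWithin (sectorRegion 1 δ) ≤ infinityWithin rightRegion ⊔
        infinityWithin (leftRegion ∩ sectorRegion 1 δ) := by
      simp only [infinityWithin]
      rw [← inf_sup_left, sup_principal]
      refine inf_le_inf_left _ (principal_mono.2 fun z hz => ?_)
      rcases cases_region z (by simpa using hz.1) hz.2.1 with hr | hl
      · exact Or.inl hr
      · exact Or.inr ⟨hl, hz⟩
    refine Tendsto.mono_left (tendsto_sup.2 ⟨?_, ?_⟩) hle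
    · refine (tendsto_branchAmplitude h2 (κ := -Complex.I) (K := 3) (by norm_num) fun z hz =>
        mem_obliqueCone_of_mem_rightRegion hz).congr' ?_
      filter_upwards [mem_inf_of_right (mem_principal_self rightRegion)] with z hz
      exact (exp_mul_dominant_right hS (re_add_im_pos_of_mem_rightRegion hz)).symm
    · have tK := tendsto_branchAmplitude h1 (κ := -Complex.I) (K := 3) (by norm_num)
        (R := leftRegion ∩ sectorRegion 1 δ) fun z hz => mem_obliqueCone_of_mem_leftRegion hz.1
      have tP := tendsto_branchAmplitude h1 (κ := Complex.I) (K := 3) (by norm_num)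
        (R := leftRegion ∩ sectorRegion 1 δ) fun z hz => mem_obliqueCone_of_im_nonneg hz.1.1
      have tE : Tendsto (fun z : ℂ => Complex.exp (2 * Complex.I * z))
          (infinityWithin (leftRegion ∩ sectorRegion 1 δ)) (𝓝 0) := by
        have t1 : Tendsto (fun z : ℂ => Real.exp (-(2 * ((1 + δ⁻¹)⁻¹ * ‖z‖))))
            (infinityWithin (leftRegion ∩ sectorRegion 1 δ)) (𝓝 0) := by
          refine Real.tendsto_exp_neg_atTop_nhds_zero.comp ?_
          exact ((tendsto_norm_cobounded_atTop.const_mul_atTop (by positivity)).const_mul_atTop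
            two_pos).mono_left inf_le_left
        refine squeeze_zero_norm' ?_ t1
        filter_upwards [mem_inf_of_right (mem_principal_self (leftRegion ∩ sectorRegion 1 δ))]
          with z hz
        rw [normE, Real.exp_le_exp, neg_le_neg_iff]
        have := norm_le_of_mem_sector hδ hz.1.1 (re_neg_of_mem_leftRegion hz.1)
          (by simpa using hz.2.2.2)
        gcongr
        rwa [inv_mul_le_iff₀ (by positivity)]
      have t := tK.add ((tE.mul tP).const_mul (2 * Complex.I))
      simp only [zero_mul, mul_zero, add_zero] at t
      refine t.congr' ?_
      filter_upwards [mem_inf_of_right (mem_principal_self (leftRegion ∩ sectorRegion 1 δ))]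
        with z hz
      exact (exp_mul_dominant_left hL (re_neg_of_mem_leftRegion hz.1)).symm
  -- On the left the derivative of the amplitude is at most `CK + 2(CP + 2 CP)`. The factor 2 covers
  -- `e^(iz) h'`, which is that derivative minus `i` times the amplitude.
  · refine ⟨2 * (CQ + CK + 6 * CP), ?_⟩
    rintro δ - z ⟨hz0, hz1, -⟩
    simp only [Complex.ofReal_one, one_mul] at hz0 ⊢
    have hd : Complex.exp (Complex.I * z) * deriv h z =
        deriv (fun w => Complex.exp (Complex.I * w) * h w) z -
          Complex.I * (Complex.exp (Complex.I * z) * h z) := by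
      have d : HasDerivAt (fun w : ℂ => Complex.I * w) Complex.I z := by
        simpa using (hasDerivAt_id z).const_mul Complex.I
      rw [(d.cexp.fun_mul (sh.hasDerivAt (mem_upperSlitPlane_of_im_nonneg hz0
        (one_le_norm_ne_zero hz1)))).deriv]
      ring
    have key : ‖Complex.exp (Complex.I * z) * h z‖ ≤ CQ + CK + 6 * CP ∧
        ‖deriv (fun w => Complex.exp (Complex.I * w) * h w) z‖ ≤ CQ + CK + 6 * CP := by
      rcases cases_region z hz0 hz1 with hr | hl
      · obtain ⟨b0, b1, -⟩ := bQ z hz1 (mem_obliqueCone_of_mem_rightRegion hr)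
        have hr' := re_add_im_pos_of_mem_rightRegion hr
        rw [exp_mul_dominant_right hS hr', deriv_exp_mul_dominant_right hS hr']
        have := deriv_le hz1 b1
        constructor <;> linarith
      · obtain ⟨b0, b1, -⟩ := bK z hz1 (mem_obliqueCone_of_mem_leftRegion hl)
        obtain ⟨c0, c1, -⟩ := bP z hz1 (mem_obliqueCone_of_im_nonneg hz0)
        have hl' := re_neg_of_mem_leftRegion hl
        have d0 := deriv_le hz1 b1
        have d1 := deriv_le hz1 c1
        rw [exp_mul_dominant_left hL hl', deriv_exp_mul_dominant_left hL hl']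
        constructor
        · refine (norm_add_le _ _).trans ?_
          rw [normI, norm_mul]
          have := mul_le_of_le_one_left (norm_nonneg (branchAmplitude Complex.I 1 z))
            (normE_le z hz0)
          linarith
        · refine (norm_add_le _ _).trans ?_
          rw [normI, norm_mul]
          have e1 := mul_le_of_le_one_left (norm_nonneg (branchAmplitudeDeriv Complex.I 1 z +
            2 * Complex.I * branchAmplitude Complex.I 1 z)) (normE_le z hz0)
          have e2 := norm_add_le (branchAmplitudeDeriv Complex.I 1 z)
            (2 * Complex.I * branchAmplitude Complex.I 1 z)
          rw [normI] at e2
          linarith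
    refine ⟨by linarith [norm_nonneg (Complex.exp (Complex.I * z) * h z)], ?_⟩
    rw [hd]
    refine (norm_sub_le _ _).trans ?_
    rw [norm_mul Complex.I, Complex.norm_I, one_mul]
    linarith
  · rintro δ ⟨hδ, -⟩
    refine ⟨CQ + CK + 2 * CP + 4 * ((1 + δ⁻¹) ^ 2 * CP), ?_⟩
    rintro z ⟨hz0, hz1, hz2⟩
    simp only [Complex.ofReal_one, one_mul] at hz0 hz2 ⊢
    have hP0 : 0 ≤ (1 + δ⁻¹) ^ 2 * CP := by positivity
    rcases cases_region z hz0 hz1 with hr | hl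
    · obtain ⟨b0, b1, -⟩ := bQ z hz1 (mem_obliqueCone_of_mem_rightRegion hr)
      rw [deriv_exp_mul_dominant_right hS (re_add_im_pos_of_mem_rightRegion hr)]
      linarith
    · obtain ⟨b0, b1, -⟩ := bK z hz1 (mem_obliqueCone_of_mem_leftRegion hl)
      obtain ⟨c0, c1, -⟩ := bP z hz1 (mem_obliqueCone_of_im_nonneg hz0)
      have hl' := re_neg_of_mem_leftRegion hl
      -- The sector gives `|z| ≤ (1 + 1/δ) Im z`, and `y² e^(-2y) ≤ 1` for `y ≥ 0`.
      have hE : ‖z‖ ^ 2 * ‖Complex.exp (2 * Complex.I * z)‖ ≤ (1 + δ⁻¹) ^ 2 := by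
        have n := norm_le_of_mem_sector hδ hz0 hl' hz2
        have n2 : ‖z‖ ^ 2 ≤ (1 + δ⁻¹) ^ 2 * z.im ^ 2 := by
          rw [← mul_pow]
          exact pow_le_pow_left₀ (norm_nonneg z) n 2
        have n3 : z.im ≤ Real.exp z.im := by linarith [Real.add_one_le_exp z.im]
        have n4 : z.im ^ 2 * Real.exp (-(2 * z.im)) ≤ 1 := by
          rw [Real.exp_neg, ← div_eq_mul_inv, div_le_one (Real.exp_pos _), two_mul, Real.exp_add,
            ← sq]
          exact pow_le_pow_left₀ hz0 n3 2
        rw [normE]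
        calc _ ≤ (1 + δ⁻¹) ^ 2 * z.im ^ 2 * Real.exp (-(2 * z.im)) := by gcongr
          _ = (1 + δ⁻¹) ^ 2 * (z.im ^ 2 * Real.exp (-(2 * z.im))) := by ring
          _ ≤ _ := mul_le_of_le_one_right (by positivity) n4
      rw [deriv_exp_mul_dominant_left hL hl']
      have e : z ^ 2 * (branchAmplitudeDeriv (-Complex.I) 1 z + 2 * Complex.I *
          (Complex.exp (2 * Complex.I * z) *
          (branchAmplitudeDeriv Complex.I 1 z + 2 * Complex.I * branchAmplitude Complex.I 1 z))) =
          z ^ 2 * branchAmplitudeDeriv (-Complex.I) 1 z + (2 * Complex.I *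
          (Complex.exp (2 * Complex.I * z) * (z ^ 2 * branchAmplitudeDeriv Complex.I 1 z)) +
          2 * Complex.I * (2 * Complex.I * (z ^ 2 * Complex.exp (2 * Complex.I * z) *
            branchAmplitude Complex.I 1 z))) := by ring
      rw [e]
      refine (norm_add_le _ _).trans ?_
      have f1 := norm_add_le (2 * Complex.I *
          (Complex.exp (2 * Complex.I * z) * (z ^ 2 * branchAmplitudeDeriv Complex.I 1 z)))
          (2 * Complex.I * (2 * Complex.I * (z ^ 2 * Complex.exp (2 * Complex.I * z) *
            branchAmplitude Complex.I 1 z)))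
      rw [normI, normI, normI, norm_mul (Complex.exp _), norm_mul (_ * _), norm_mul (z ^ 2) (Complex.exp _),
        norm_pow] at f1
      have f2 := mul_le_of_le_one_left (norm_nonneg (z ^ 2 * branchAmplitudeDeriv Complex.I 1 z))
        (normE_le z hz0)
      have f3 : ‖z‖ ^ 2 * ‖Complex.exp (2 * Complex.I * z)‖ * ‖branchAmplitude Complex.I 1 z‖ ≤
        (1 + δ⁻¹) ^ 2 * CP := by gcongr
      linarith
  · intro C hC
    simp only [Complex.ofReal_one, one_mul] at hC
    set g' : ℂ → ℂ := deriv fun w => Complex.exp (Complex.I * w) * h w with hg'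
    refine tendsto_atTop.2 fun M => ?_
    -- On the negative axis the Stokes term does not decay: it contributes `4x²` times an amplitude
    -- of modulus at least `1/2`, and the other terms stay bounded by `CK + 2 CP`.
    obtain ⟨x, hx1, hxM⟩ : ∃ x : ℝ, x ≤ -1 ∧ M < ‖(x : ℂ) ^ 2 * g' x‖ := by
      have tP' := tP.eventually (Metric.ball_mem_nhds 1 (ε := 1 / 2) (by norm_num))
      obtain ⟨x, hxP, hx1, hxM⟩ := (tP'.and ((eventually_le_atBot (-1)).and
        (eventually_le_atBot (-(|M| + CK + 2 * CP + 1))))).exists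
      refine ⟨x, hx1, ?_⟩
      have hxl : (x : ℂ) ∈ leftRegion := neg_mem x hx1
      obtain ⟨b0, b1, -⟩ := bK x hxl.2.1 (mem_obliqueCone_of_mem_leftRegion hxl)
      obtain ⟨c0, c1, -⟩ := bP x hxl.2.1 (mem_obliqueCone_of_im_nonneg hxl.1)
      have hP2 : 1 / 2 ≤ ‖branchAmplitude Complex.I 1 x‖ := by
        have hb : ‖1 - branchAmplitude Complex.I 1 x‖ < 1 / 2 := by
          rw [dist_comm, dist_eq_norm] at hxP
          exact hxP
        have := norm_sub_norm_le 1 (branchAmplitude Complex.I 1 x)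
        rw [norm_one] at this
        linarith
      have nE : ‖Complex.exp (2 * Complex.I * x)‖ = 1 := by rw [normE]; simp
      rw [hg', deriv_exp_mul_dominant_left hL (re_neg_of_mem_leftRegion hxl)]
      have e : (x : ℂ) ^ 2 * (branchAmplitudeDeriv (-Complex.I) 1 x + 2 * Complex.I *
          (Complex.exp (2 * Complex.I * x) *
          (branchAmplitudeDeriv Complex.I 1 x + 2 * Complex.I * branchAmplitude Complex.I 1 x))) =
          (2 * Complex.I * (2 * Complex.I * (x ^ 2 * Complex.exp (2 * Complex.I * x) *
            branchAmplitude Complex.I 1 x))) - (-(x ^ 2 * branchAmplitudeDeriv (-Complex.I) 1 x) -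
          2 * Complex.I *
            (Complex.exp (2 * Complex.I * x) * (x ^ 2 * branchAmplitudeDeriv Complex.I 1 x))) := by
        ring
      rw [e]
      refine lt_of_lt_of_le ?_ (norm_sub_norm_le _ _)
      have f1 := norm_sub_le (-((x : ℂ) ^ 2 * branchAmplitudeDeriv (-Complex.I) 1 x))
        (2 * Complex.I *
          (Complex.exp (2 * Complex.I * x) * (x ^ 2 * branchAmplitudeDeriv Complex.I 1 x)))
      rw [norm_neg, normI, norm_mul (Complex.exp _), nE, one_mul] at f1
      rw [normI, normI, norm_mul (_ * _), norm_mul, nE, mul_one, norm_pow, Complex.norm_real,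
        Real.norm_eq_abs, sq_abs]
      have f2 : x ^ 2 * (1 / 2) ≤ x ^ 2 * ‖branchAmplitude Complex.I 1 x‖ := by gcongr
      have f3 : |M| + CK + 2 * CP + 1 ≤ x ^ 2 := by nlinarith
      have := le_abs_self M
      nlinarith [abs_nonneg M]
    have hgx : ContinuousAt (fun z : ℂ => z ^ 2 * g' z) x := by
      refine (continuousAt_id.pow 2).mul (AnalyticAt.deriv ?_).continuousAt
      have : AnalyticAt ℂ (fun w : ℂ => Complex.exp (Complex.I * w)) x := by fun_prop
      exact this.mul (sh.1 x (Or.inr (by simp; linarith)))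
    -- These points lie on the boundary ray of the sector with parameter `δ` and tend to `x`, so any
    -- admissible constant eventually exceeds `M`.
    have hpath : ContinuousAt (fun δ : ℝ => (x : ℂ) + ((δ * -x : ℝ) : ℂ) * Complex.I) 0 := by
      fun_prop
    have hcomp : ContinuousAt (fun δ : ℝ => ‖((x : ℂ) + ((δ * -x : ℝ) : ℂ) * Complex.I) ^ 2 *
        g' ((x : ℂ) + ((δ * -x : ℝ) : ℂ) * Complex.I)‖) 0 := by
      refine (ContinuousAt.comp (f := fun δ : ℝ => (x : ℂ) + ((δ * -x : ℝ) : ℂ) * Complex.I)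
        (g := fun z : ℂ => z ^ 2 * g' z) ?_ hpath).norm
      simpa using hgx
    have hev : ∀ᶠ δ : ℝ in 𝓝[>] 0, M < ‖((x : ℂ) + ((δ * -x : ℝ) : ℂ) * Complex.I) ^ 2 *
        g' ((x : ℂ) + ((δ * -x : ℝ) : ℂ) * Complex.I)‖ :=
      (hcomp.eventually (lt_mem_nhds (by simpa using hxM))).filter_mono nhdsWithin_le_nhds
    filter_upwards [hev, Ioo_mem_nhdsGT one_pos] with δ hδ hδ'
    refine hδ.le.trans (hC δ hδ' _ ⟨?_, ?_, ?_⟩)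
    · simp
      nlinarith [hδ'.1]
    · refine le_trans ?_ (Complex.abs_re_le_norm _)
      simp
      rw [abs_of_neg] <;> linarith
    · simp
  · have tK := (tendsto_branchAmplitude h1 (κ := -Complex.I) (K := 3) (by norm_num)
      fun z hz => mem_obliqueCone_of_mem_leftRegion hz).comp tneg
    simp only [Complex.ofReal_one, one_mul]
    -- The comparison function has modulus at least `2 - 1 = 1`, so the equivalence reduces to the
    -- difference tending to zero.
    have hO : (fun _ : ℝ => (1 : ℝ)) =O[atBot] fun x : ℝ => Complex.exp (-(Complex.I * x)) +
        2 * Complex.I * Complex.exp (Complex.I * x) := by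
      refine IsBigO.of_bound 1 (Eventually.of_forall fun x => ?_)
      have := norm_sub_norm_le (2 * Complex.I * Complex.exp (Complex.I * x))
        (-Complex.exp (-(Complex.I * x)))
      rw [normI, norm_neg, nE1, nE2, sub_neg_eq_add, add_comm (2 * Complex.I * _)] at this
      rw [norm_one, one_mul]
      linarith
    refine IsLittleO.trans_isBigO ?_ hO
    rw [isLittleO_one_iff]
    have t : Tendsto (fun x : ℝ => ‖branchAmplitude (-Complex.I) 1 x - 1‖ +
        2 * ‖branchAmplitude Complex.I 1 x - 1‖) atBot (𝓝 (‖(1 : ℂ) - 1‖ + 2 * ‖(1 : ℂ) - 1‖)) :=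
      (tK.sub_const 1).norm.add ((tP.sub_const 1).norm.const_mul 2)
    simp only [sub_self, norm_zero, mul_zero, add_zero] at t
    refine squeeze_zero_norm' ?_ t
    filter_upwards [eventually_lt_atBot 0] with x hx
    have e : h x - (Complex.exp (-(Complex.I * x)) + 2 * Complex.I * Complex.exp (Complex.I * x)) =
        Complex.exp (-(Complex.I * x)) * (branchAmplitude (-Complex.I) 1 x - 1) +
          2 * Complex.I * (Complex.exp (Complex.I * x) * (branchAmplitude Complex.I 1 x - 1)) := by
      rw [hL x (by simpa using hx), besselBranch, besselBranch, neg_mul]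
      ring
    simp only [Pi.sub_apply]
    rw [e]
    refine (norm_add_le _ _).trans ?_
    rw [normI, norm_mul, norm_mul, nE1, nE2, one_mul, one_mul]

/-! ### Reflection to the lower half-plane. -/

/-- The mirror image `z ↦ conj (f (conj z))` of `f`. -/
noncomputable def conjMirror (f : ℂ → ℂ) : ℂ → ℂ := conj ∘ f ∘ conj

theorem conjMirror_apply (f : ℂ → ℂ) (z : ℂ) : conjMirror f z = conj (f (conj z)) := rfl

theorem conjMirror_eq (f : ℂ → ℂ) : conjMirror f = fun z => conj (f (conj z)) := rfl

theorem deriv_conjMirror (f : ℂ → ℂ) : deriv (conjMirror f) = conjMirror (deriv f) :=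
  deriv_conj_conj

theorem AnalyticAt.conjMirror {f : ℂ → ℂ} {z : ℂ} (hf : AnalyticAt ℂ f (conj z)) :
    AnalyticAt ℂ (conjMirror f) z := by
  rw [Complex.analyticAt_iff_eventually_differentiableAt] at hf ⊢
  filter_upwards [Complex.continuous_conj.continuousAt.eventually hf] with w hw
  have := hw.hasDerivAt.conj_conj.differentiableAt
  rwa [Complex.conj_conj] at this

/-- Reflection commutes with differentiation, and the coefficient `1 + 1/(4z²)` is real on the real
axis, hence its own mirror image. -/
theorem IsBesselSolutionOn.conjMirror {U V : Set ℂ} {h : ℂ → ℂ} (hh : IsBesselSolutionOn U h)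
    (hV : ∀ z ∈ V, conj z ∈ U) : IsBesselSolutionOn V (conjMirror h) := by
  refine ⟨fun z hz => (hh.1 _ (hV z hz)).conjMirror, fun z hz => ?_⟩
  have := congrArg conj (hh.2 _ (hV z hz))
  rw [deriv_conjMirror, deriv_conjMirror]
  simpa [conjMirror_apply, map_ofNat] using this

theorem IsBesselFundamentalSystemOn.conjMirror {U V : Set ℂ} {f g : ℂ → ℂ}
    (hfg : IsBesselFundamentalSystemOn U f g) (hV : ∀ z ∈ V, conj z ∈ U)
    (hU : ∀ z ∈ U, conj z ∈ V) :
    IsBesselFundamentalSystemOn V (conjMirror f) (conjMirror g) := by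
  obtain ⟨hf, hg, hu⟩ := hfg
  refine ⟨hf.conjMirror hV, hg.conjMirror hV, fun h hh => ?_⟩
  obtain ⟨⟨a, b⟩, hab, huniq⟩ := hu _ (hh.conjMirror hU)
  refine ⟨(conj a, conj b), fun z hz => ?_, ?_⟩
  · have := congrArg conj (hab _ (hV z hz))
    simpa [conjMirror_apply] using this
  · rintro ⟨a', b'⟩ hab'
    have := huniq (conj a', conj b') fun z hz => by
      have := congrArg conj (hab' _ (hU z hz))
      simpa [conjMirror_apply] using this
    simp only [Prod.mk.injEq] at this ⊢
    rw [← this.1, ← this.2]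
    simp

theorem Asymptotics.IsEquivalent.conj {α : Type*} {l : Filter α} {f g : α → ℂ} (h : f ~[l] g) :
    (fun x => conj (f x)) ~[l] fun x => conj (g x) := by
  refine IsLittleO.of_norm_norm ?_
  refine (IsLittleO.norm_norm h).congr (fun x => ?_) (fun x => ?_)
  · simp only [Pi.sub_apply]
    rw [← map_sub, Complex.norm_conj]
  · rw [Complex.norm_conj]

theorem tendsto_conj_infinityWithin {S T : Set ℂ} (h : ∀ z ∈ T, conj z ∈ S) :
    Tendsto conj (infinityWithin T) (infinityWithin S) := by
  refine tendsto_inf.2 ⟨?_, tendsto_principal.2 ?_⟩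
  · rw [← tendsto_norm_atTop_iff_cobounded]
    simp only [Complex.norm_conj]
    exact tendsto_norm_cobounded_atTop.mono_left inf_le_left
  · filter_upwards [mem_inf_of_right (mem_principal_self T)] with z hz using h z hz

theorem conj_mem_openHalfPlane {ε : ℝ} {z : ℂ} (hz : z ∈ openHalfPlane ε) :
    conj z ∈ openHalfPlane (-ε) := by
  simpa [openHalfPlane] using hz

theorem conj_mem_puncturedClosedHalfPlane {ε : ℝ} {z : ℂ} (hz : z ∈ puncturedClosedHalfPlane ε) :
    conj z ∈ puncturedClosedHalfPlane (-ε) := by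
  simpa [puncturedClosedHalfPlane] using hz

theorem conj_mem_exteriorRegion {ε : ℝ} {z : ℂ} (hz : z ∈ exteriorRegion ε) :
    conj z ∈ exteriorRegion (-ε) := by
  simpa [exteriorRegion] using hz

theorem conj_mem_sectorRegion {ε δ : ℝ} {z : ℂ} (hz : z ∈ sectorRegion ε δ) :
    conj z ∈ sectorRegion (-ε) δ := by
  simpa only [sectorRegion, mem_ofPred_eq, Complex.conj_im, Complex.conj_re, neg_mul_neg,
    Complex.norm_conj] using hz

theorem conjMirror_exp_mul (c : ℂ) (f : ℂ → ℂ) :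
    conjMirror (fun w => Complex.exp (c * w) * f w) =
      fun w => Complex.exp (conj c * w) * conjMirror f w := by
  funext w
  simp [conjMirror_apply, ← Complex.exp_conj]

theorem norm_pow_mul_conjMirror (n : ℕ) (f : ℂ → ℂ) (z : ℂ) :
    ‖z ^ n * conjMirror f z‖ = ‖(conj z) ^ n * f (conj z)‖ := by
  simp [conjMirror_apply]

theorem norm_exp_mul_conjMirror (c : ℂ) (f : ℂ → ℂ) (z : ℂ) :
    ‖Complex.exp (conj c * z) * conjMirror f z‖ = ‖Complex.exp (c * conj z) * f (conj z)‖ := by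
  rw [← Complex.norm_conj]
  simp [conjMirror_apply, ← Complex.exp_conj]

theorem conj_neg_one_mul_I : conj (-((1 : ℝ) * Complex.I)) = -(((-1 : ℝ) : ℂ) * Complex.I) := by
  simp

theorem conj_one_mul_I : conj ((1 : ℝ) * Complex.I) = ((-1 : ℝ) : ℂ) * Complex.I := by
  simp

theorem IsBesselBranchPair.conjMirror {hp hm : ℂ → ℂ} (h : IsBesselBranchPair 1 hp hm) :
    IsBesselBranchPair (-1) (conjMirror hp) (conjMirror hm) := by
  obtain ⟨h1, h2, h3, h4, ⟨C, h5⟩, h6, ⟨C', h7⟩, h8, h9, h10⟩ := h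
  simp only [← neg_mul (_ * _) _] at h5
  have t1 : ∀ z ∈ openHalfPlane (-1), conj z ∈ openHalfPlane 1 := fun z hz => by
    simpa using conj_mem_openHalfPlane hz
  have t2 : ∀ z ∈ puncturedClosedHalfPlane (-1), conj z ∈ puncturedClosedHalfPlane 1 :=
    fun z hz => by simpa using conj_mem_puncturedClosedHalfPlane hz
  have t3 : ∀ z ∈ exteriorRegion (-1), conj z ∈ exteriorRegion 1 :=
    fun z hz => by simpa using conj_mem_exteriorRegion hz
  have t4 : ∀ δ, ∀ z ∈ sectorRegion (-1) δ, conj z ∈ sectorRegion 1 δ :=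
    fun δ z hz => by simpa using conj_mem_sectorRegion hz
  refine ⟨h1.conjMirror t1 fun z hz => conj_mem_openHalfPlane hz, h2.conjMirror t2,
    h3.conjMirror t2, ?_, ⟨C, fun z hz => ?_⟩, fun δ hδ => ?_, ⟨C', fun δ hδ z hz => ?_⟩,
    fun δ hδ => ?_, fun D hD => h9 D fun δ hδ z hz => ?_, ?_⟩
  · have := (h4.comp_tendsto (tendsto_conj_infinityWithin t3)).conj
    simpa [← Complex.exp_conj, Function.comp_def, conjMirror_eq] using this
  · simp only [← neg_mul (_ * _) _]
    rw [← conj_neg_one_mul_I, ← conjMirror_exp_mul, deriv_conjMirror, deriv_conjMirror,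
      norm_exp_mul_conjMirror, norm_pow_mul_conjMirror, norm_pow_mul_conjMirror]
    exact h5 _ (t3 z hz)
  · have := ((h6 δ hδ).comp_tendsto (tendsto_conj_infinityWithin (t4 δ))).conj
    simpa [← Complex.exp_conj, Function.comp_def, conjMirror_eq] using this
  · rw [← conj_one_mul_I, deriv_conjMirror, norm_exp_mul_conjMirror, norm_exp_mul_conjMirror]
    exact h7 δ hδ _ (t4 δ z hz)
  · obtain ⟨B, hB⟩ := h8 δ hδ
    refine ⟨B, fun z hz => ?_⟩
    rw [← conj_one_mul_I, ← conjMirror_exp_mul, deriv_conjMirror, norm_pow_mul_conjMirror]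
    exact hB _ (t4 δ z hz)
  -- The blow-up transfers in the opposite direction: constants admissible for the mirror image are
  -- admissible for the original.
  · have := hD δ hδ (conj z) (conj_mem_sectorRegion hz)
    rw [← conj_one_mul_I, ← conjMirror_exp_mul, deriv_conjMirror, norm_pow_mul_conjMirror,
      Complex.conj_conj] at this
    exact this
  · have := h10.conj
    simpa [← Complex.exp_conj, conjMirror_apply, map_ofNat] using this

/-- The case `ε = 1` is the upper half-plane; `ε = -1` is the analogous statement in the lower
half-plane (the mirror image under complex conjugation). `hp` is the recessive branch and `hm`
the dominant one. -/
theorem lemma4 (ε : ℝ) (hε : ε = 1 ∨ ε = -1) :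
    ∃ hp hm : ℂ → ℂ,
      -- a holomorphic fundamental system in the open half-plane
      IsBesselFundamentalSystemOn (openHalfPlane ε) hp hm ∧
      -- which extends holomorphically across the punctured real line, as a pair of solutions
      IsBesselSolutionOn (puncturedClosedHalfPlane ε) hp ∧
      IsBesselSolutionOn (puncturedClosedHalfPlane ε) hm ∧
      -- the recessive branch
      (hp ~[infinityWithin (exteriorRegion ε)] fun z => Complex.exp (ε * Complex.I * z)) ∧
      (∃ C : ℝ, ∀ z ∈ exteriorRegion ε,
        ‖Complex.exp (-(ε * Complex.I * z)) * hp z‖ ≤ C ∧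
        ‖z ^ 2 * deriv (fun w => Complex.exp (-(ε * Complex.I * w)) * hp w) z‖ ≤ C ∧
        ‖z ^ 3 * deriv (deriv (fun w => Complex.exp (-(ε * Complex.I * w)) * hp w)) z‖ ≤ C) ∧
      -- the dominant branch: asymptotics in every sector
      (∀ δ ∈ Set.Ioo (0 : ℝ) 1,
        hm ~[infinityWithin (sectorRegion ε δ)] fun z => Complex.exp (-(ε * Complex.I * z))) ∧
      -- the dominant branch: bounds with a constant that does not depend on the sector
      (∃ C : ℝ, ∀ δ ∈ Set.Ioo (0 : ℝ) 1, ∀ z ∈ sectorRegion ε δ,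
        ‖Complex.exp (ε * Complex.I * z) * hm z‖ ≤ C ∧
        ‖Complex.exp (ε * Complex.I * z) * deriv hm z‖ ≤ C) ∧
      -- the dominant branch: the bound with a constant that depends on the sector
      (∀ δ ∈ Set.Ioo (0 : ℝ) 1, ∃ C : ℝ, ∀ z ∈ sectorRegion ε δ,
        ‖z ^ 2 * deriv (fun w => Complex.exp (ε * Complex.I * w) * hm w) z‖ ≤ C) ∧
      -- every admissible choice of the latter constants blows up as `δ → 0+`
      (∀ C : ℝ → ℝ,
        (∀ δ ∈ Set.Ioo (0 : ℝ) 1, ∀ z ∈ sectorRegion ε δ,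
          ‖z ^ 2 * deriv (fun w => Complex.exp (ε * Complex.I * w) * hm w) z‖ ≤ C δ) →
        Tendsto C (𝓝[>] 0) atTop) ∧
      -- the Stokes constant
      ((fun x : ℝ => hm x) ~[atBot] fun x : ℝ =>
        Complex.exp (-(ε * Complex.I * x)) + 2 * (ε * Complex.I) * Complex.exp (ε * Complex.I * x)) := by
  obtain ⟨hp, hm, h⟩ := exists_isBesselBranchPair_one
  rcases hε with rfl | rfl
  · exact ⟨hp, hm, h⟩
  · exact ⟨conjMirror hp, conjMirror hm, h.conjMirror⟩
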